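/- For $n\ge 1$ let $$c_n=\sum_{\substack{1\le k<n\\ 1<n_1<\cdots<n_{k-1}<n_k=n}}\frac{(-1)^{k+1}}{k}{n_2\brace n_1}{n_3\brace n_2}\cdots{n_k\brace n_{k-1}}\in\mathbb Q ,$$ where ${j\brace i}$ denotes the Stirling numbers of the second kind (so $c_1=0$, $c_2=1$, $c_3=-\tfrac12,\dots$). A reference sequence is a sequence $\Omega=(\Omega_n)_{n\ge0}$ of non-zero rational numbers with $\Omega_0=\Omega_1=1$. For $f\in z\mathbb Q[[z]]$ with linear coefficient $1$, the iteration matrix $[f]^\Omega=([f]^\Omega_{ij})_{i,j\ge0}$ is the upper triangular matrix, with diagonal entries $1$, given by $\Omega_i f^i=\sum_{j\ge0}[f]^\Omega_{ij}\,\Omega_j z^j$, and its logarithm is $\log [f]^\Omega=\sum_{n\ge1}\frac{(-1)^{n+1}}{n}([f]^\Omega-1)^n$. For $h=\sum_{n\ge1}h_nz^n$, let $\langle h\rangle^\Omega$ be the upper triangular matrix with entries $\langle h\rangle^\Omega_{ij}=\frac{\Omega_i}{\Omega_j}\,i\,h_{j-i+1}$ for $i\le j$. The iterative logarithm $\operatorname{itlog}(f)$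 is the unique $h\in z^2\mathbb Q[[z]]$ such that $\log[f]^\Omega=\langle h\rangle^\Omega$ for every reference sequence $\Omega$. Then the exponential generating function of $(c_n)$ is the iterative logarithm of $e^z-1$: $$\sum_{n\ge1}c_n\frac{z^n}{n!}=\operatorname{itlog}(e^z-1)$$ (in particular, the power series defining $\operatorname{itlog}(e^z-1)$ exists and is unique), and this power series is differentially transcendental: writing $y$ for it, there are no $r\ge0$ and no non-zero polynomial $P\in\mathbb Q[z][Y_0,\dots,Y_r]$ with $P(y,y',\dots,y^{(r)})=0$, and likewise no such non-zero polynomial $P\in\mathbb C[z][Y_0,\dots,Y_r]$. -/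

import Mathlib

/-! ### Infinite upper triangular matrices, indexed by pairs of natural numbers -/

namespace IterLog

/-- The product of two upper triangular `ℕ × ℕ` matrices. The terms `M i k * N k j` with `k > j`
vanish because `N` is upper triangular, so that the sum over all `k` is a finite sum. -/
def triMul {K : Type*} [Field K] (M N : ℕ → ℕ → K) : ℕ → ℕ → K :=
  fun i j => ∑ k ∈ Finset.range (j + 1), M i k * N k j

/-- The identity matrix. -/
def triOne (K : Type*) [Field K] : ℕ → ℕ → K :=
  fun i j => if i = j then 1 else 0

/-- Powers of an upper triangular matrix. -/
def triPow {K : Type*} [Field K] (M : ℕ → ℕ → K) : ℕ → ℕ → ℕ → K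
  | 0 => triOne K
  | n + 1 => triMul (triPow M n) M

/-- The logarithm `∑_{n ≥ 1} (-1)^(n+1) (M - 1)^n / n` of an upper triangular matrix `M` all of whose
diagonal entries are `1`. The `(i, j)` entry of `(M - 1)^n` vanishes for `n > j - i`, so that
the terms with `1 ≤ n ≤ j` are all that contribute to the entry `(i, j)`. -/
def triLog {K : Type*} [Field K] (M : ℕ → ℕ → K) : ℕ → ℕ → K :=
  fun i j => ∑ n ∈ Finset.Icc 1 j, (-1) ^ (n + 1) / (n : K) * triPow (M - triOne K) n i j

/-- A reference sequence: a sequence of non-zero rational numbers with `Ω₀ = Ω₁ = 1`. -/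
def IsReferenceSequence (Ω : ℕ → ℚ) : Prop :=
  (∀ n, Ω n ≠ 0) ∧ Ω 0 = 1 ∧ Ω 1 = 1

/-- The iteration matrix `[f]^Ω` of a power series `f` without constant term. Its entries are
determined by `Ω_i f^i = ∑_j [f]^Ω_{ij} Ω_j z^j`. -/
noncomputable def iterationMatrix {K : Type*} [Field K] (Ω : ℕ → ℚ) (f : PowerSeries K) :
    ℕ → ℕ → K :=
  fun i j => ((Ω i / Ω j : ℚ) : K) * PowerSeries.coeff j (f ^ i)

/-- The infinitesimal iteration matrix `⟨h⟩^Ω` of a power series `h = ∑_{n ≥ 1} h_n z^n`: the upper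
triangular matrix with entries `(Ω_i / Ω_j) i h_{j-i+1}` for `i ≤ j`. -/
noncomputable def infinitesimalMatrix {K : Type*} [Field K] (Ω : ℕ → ℚ) (h : PowerSeries K) :
    ℕ → ℕ → K :=
  fun i j => if i ≤ j then
    ((Ω i / Ω j : ℚ) : K) * (i : K) * PowerSeries.coeff (j - i + 1) h else 0

/-- `h` is the iterative logarithm of the power series `f = z + ⋯`: it lies in `z² K[[z]]` and
`log [f]^Ω = ⟨h⟩^Ω` for every reference sequence `Ω`. -/
def IsIterativeLog {K : Type*} [Field K] (f h : PowerSeries K) : Prop :=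
  PowerSeries.X ^ 2 ∣ h ∧
    ∀ Ω : ℕ → ℚ, IsReferenceSequence Ω →
      triLog (iterationMatrix Ω f) = infinitesimalMatrix Ω h

/-! ### The sequence `(c_n)` and its exponential generating function -/

/-- The increasing chains `1 < n_1 < ⋯ < n_{m+1} = n` of natural numbers; `v i` is `n_{i+1}`. -/
def chains (n m : ℕ) : Finset (Fin (m + 1) → ℕ) :=
  (Fintype.piFinset fun _ => Finset.Icc 2 n).filter fun v =>
    (∀ i : Fin m, v i.castSucc < v i.succ) ∧ v (Fin.last m) = n

/-- The sum over `1 ≤ k < n` and `1 < n_1 < ⋯ < n_k = n` of `(-1)^(k+1)/k` times the product of the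
Stirling numbers of the second kind `{n_2 \brace n_1} ⋯ {n_k \brace n_{k-1}}`;
the summation index is `m = k - 1`. -/
def cSeq (n : ℕ) : ℚ :=
  ∑ m ∈ Finset.range (n - 1), ∑ v ∈ chains n m,
    (-1) ^ (m + 2) / ((m : ℚ) + 1) *
      ∏ i : Fin m, (Nat.stirlingSecond (v i.succ) (v i.castSucc) : ℚ)

/-- The exponential generating function `∑_{n ≥ 1} c_n z^n / n!`; note that `cSeq 0 = 0`. -/
noncomputable def cEgf : PowerSeries ℚ :=
  PowerSeries.mk fun n => cSeq n / (n.factorial : ℚ)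

/-! ### Algebraic differential equations -/

/-- `f` satisfies an algebraic differential equation over `K[z]`: there is a non-zero differential
polynomial `P` over `K[z]`, the variable with index `n` standing for the `n`-th derivative of the
unknown, that vanishes when `f, f', f'', …` are substituted for the variables. -/
def DifferentiallyAlgebraic {K : Type*} [Field K] (f : PowerSeries K) : Prop :=
  ∃ P : MvPolynomial ℕ (Polynomial K), P ≠ 0 ∧
    MvPolynomial.aeval (fun n : ℕ => (PowerSeries.derivative K)^[n] f) P = 0

/-- `f` satisfies no algebraic differential equation over `K[z]`. -/
def DifferentiallyTranscendental {K : Type*} [Field K] (f : PowerSeries K) : Prop :=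
  ¬ DifferentiallyAlgebraic f

end IterLog

/-! Let `φ` be substitution of `e^z - 1` in power series. In the basis `z^i`, rescaled by `Ω`, the
iteration matrix represents `φ`, so its logarithm represents `log φ = ∑ (-1)^(n+1) (φ - 1)^n / n`.
The coefficients of `φ^N g` are polynomials in `N` whose derivative at `0` gives `log φ`;
multiplicativity of `φ^N` then makes `log φ` a derivation, hence equal to `h · d/dz` with `h = (log
φ)(z)`. This yields existence and uniqueness of the iterative logarithm (`isIterativeLog_iff`), and
since `log φ` commutes with `φ`, Julia's equation `h(e^z - 1) = e^z h`. Expanding the powers of `φ -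
1` over chains of exponents produces the Stirling sums `c_n`.

For transcendence, suppose that `h` is differentially algebraic. Then it lies in the algebraic
closure of a finite set `S`, and that closure is stable under `d = d/dz`. The iterated exponentials
`e_n = φ^n(e^z)` are algebraically independent, so for large `n` each `e_n` is transcendental over
`S` and its predecessors. Julia's equation gives `v_n := φ^n h = h e_0 ⋯ e_{n-1}`. The derivation `D
= h d` commutes with `φ`, and `D v_n = v_n s_n` with `s_{n+1} = s_n + v_n`. Climbing this tower
produces ever longer algebraically independent jets `v_n, D v_n, …` (`algebraicIndependent_jets`).
As these are images under `φ^n` of the jets of `h`, the elements `D^i h` with `i ≤ |S|` are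
algebraically independent inside a closure of rank at most `|S|`, a contradiction. -/

namespace IterLog

open Polynomial

/-! ### Polynomials over a subalgebra and derivations -/

section DerivationCoefficients

variable {K A : Type*} [Field K] [CommRing A] [Algebra K A]

/-- The polynomials all of whose coefficients lie in the subalgebra `R`. -/
def coeffSubalgebra (R : Subalgebra K A) : Subalgebra K A[X] where
  carrier := {p | ∀ i, p.coeff i ∈ R}
  mul_mem' {p q} hp hq i := by
    rw [coeff_mul]
    exact sum_mem fun x _ => mul_mem (hp _) (hq _)
  add_mem' {p q} hp hq i := by
    rw [coeff_add]
    exact add_mem (hp i) (hq i)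
  algebraMap_mem' r i := by
    rw [Polynomial.algebraMap_apply, coeff_C]
    split_ifs
    · exact R.algebraMap_mem r
    · exact R.zero_mem

theorem C_mem_coeffSubalgebra {R : Subalgebra K A} {a : A} (ha : a ∈ R) :
    C a ∈ coeffSubalgebra R := fun i => by
  rw [coeff_C]
  split_ifs
  · exact ha
  · exact R.zero_mem

theorem X_mem_coeffSubalgebra (R : Subalgebra K A) : (X : A[X]) ∈ coeffSubalgebra R := fun i => by
  rw [coeff_X]
  split_ifs
  · exact R.one_mem
  · exact R.zero_mem

theorem derivative_mem_coeffSubalgebra {R : Subalgebra K A} {p : A[X]}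
    (hp : p ∈ coeffSubalgebra R) : derivative p ∈ coeffSubalgebra R := fun i => by
  rw [coeff_derivative]
  exact mul_mem (hp _) (add_mem (natCast_mem R i) R.one_mem)

theorem eval_mem_of_coeff_mem {R : Subalgebra K A} {p : A[X]} {x : A}
    (hp : p ∈ coeffSubalgebra R) (hx : x ∈ R) : p.eval x ∈ R := by
  rw [eval_eq_sum]
  exact sum_mem fun i _ => mul_mem (hp i) (pow_mem hx i)

theorem isAlgebraic_subalgebra_iff {R : Subalgebra K A} {x : A} :
    IsAlgebraic R x ↔ ∃ p ∈ coeffSubalgebra R, p ≠ 0 ∧ p.eval x = 0 := by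
  constructor
  · rintro ⟨p, hp, hx⟩
    refine ⟨p.map (algebraMap R A), fun i => ?_, ?_, ?_⟩
    · rw [coeff_map]
      exact (p.coeff i).2
    · exact (Polynomial.map_ne_zero_iff Subtype.val_injective).2 hp
    · rwa [eval_map_algebraMap]
  · rintro ⟨p, hp, h0, hx⟩
    have hl : p ∈ lifts (algebraMap R A) :=
      (lifts_iff_coeff_lifts p).2 fun i => ⟨⟨p.coeff i, hp i⟩, rfl⟩
    obtain ⟨q, rfl⟩ := (mem_lifts p).1 hl
    refine ⟨q, fun h => h0 (by rw [h, Polynomial.map_zero]), ?_⟩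
    rwa [eval_map_algebraMap] at hx

/-- The coefficientwise extension of a derivation to polynomials. -/
noncomputable def coeffDerivation (d : Derivation K A A) : Derivation K A[X] A[X] :=
  PolynomialModule.equivPolynomialSelf.compDer d.mapCoeffs

theorem coeff_coeffDerivation (d : Derivation K A A) (p : A[X]) (i : ℕ) :
    (coeffDerivation d p).coeff i = d (p.coeff i) := rfl

theorem derivation_eval (d : Derivation K A A) (p : A[X]) (x : A) :
    d (p.eval x) = (coeffDerivation d p).eval x + (derivative p).eval x * d x := by
  have hd : ∀ n a, coeffDerivation d (monomial n a) = monomial n (d a) := fun n a => by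
    ext i
    rw [coeff_coeffDerivation, coeff_monomial, coeff_monomial, apply_ite d, map_zero]
  induction p using Polynomial.induction_on' with
  | add p q hp hq => simp only [eval_add, map_add, hp, hq]; ring
  | monomial n a =>
    rw [hd, derivative_monomial, eval_monomial, eval_monomial, eval_monomial, Derivation.leibniz,
      Derivation.leibniz_pow]
    simp only [smul_eq_mul, nsmul_eq_mul]
    ring

theorem coeffDerivation_mem {R : Subalgebra K A} {d : Derivation K A A} (hR : ∀ a ∈ R, d a ∈ R)
    {p : A[X]} (hp : p ∈ coeffSubalgebra R) : coeffDerivation d p ∈ coeffSubalgebra R :=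
  fun i => hR _ (hp i)

theorem natDegree_coeffDerivation_le (d : Derivation K A A) (p : A[X]) :
    (coeffDerivation d p).natDegree ≤ p.natDegree :=
  natDegree_le_iff_coeff_eq_zero.2 fun i hi => by
    rw [coeff_coeffDerivation, coeff_eq_zero_of_natDegree_lt hi, map_zero]

/-- Stands in for the minimal polynomial, as `R` need not be a field: an annihilator of smaller
degree built from `p` must vanish identically. -/
theorem exists_minimal_annihilator {R : Subalgebra K A} {x : A} (hx : IsAlgebraic R x) :
    ∃ p ∈ coeffSubalgebra R, p ≠ 0 ∧ p.eval x = 0 ∧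
      ∀ q ∈ coeffSubalgebra R, q.eval x = 0 → q.natDegree < p.natDegree → q = 0 := by
  classical
  have h : ∃ n, ∃ p ∈ coeffSubalgebra R, p ≠ 0 ∧ p.eval x = 0 ∧ p.natDegree = n := by
    obtain ⟨p, hp, h0, h⟩ := isAlgebraic_subalgebra_iff.1 hx
    exact ⟨_, p, hp, h0, h, rfl⟩
  obtain ⟨p, hp, h0, hpx, hn⟩ := Nat.find_spec h
  refine ⟨p, hp, h0, hpx, fun q hq hqx hlt => ?_⟩
  by_contra hq0
  exact Nat.find_min h (hn ▸ hlt) ⟨q, hq, hq0, hqx, rfl⟩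

theorem mem_adjoin_insert {S : Set A} {t x : A} (hx : x ∈ Algebra.adjoin K (insert t S)) :
    ∃ p ∈ coeffSubalgebra (Algebra.adjoin K S), p.eval t = x := by
  induction hx using Algebra.adjoin_induction with
  | mem y hy =>
    rcases hy with rfl | hy
    · exact ⟨X, X_mem_coeffSubalgebra _, eval_X⟩
    · exact ⟨C y, C_mem_coeffSubalgebra (Algebra.subset_adjoin hy), eval_C⟩
  | algebraMap r =>
    exact ⟨C (algebraMap K A r), C_mem_coeffSubalgebra (Subalgebra.algebraMap_mem _ r), eval_C⟩
  | add y z _ _ hy hz =>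
    obtain ⟨p, hp, rfl⟩ := hy
    obtain ⟨q, hq, rfl⟩ := hz
    exact ⟨p + q, add_mem hp hq, eval_add⟩
  | mul y z _ _ hy hz =>
    obtain ⟨p, hp, rfl⟩ := hy
    obtain ⟨q, hq, rfl⟩ := hz
    exact ⟨p * q, mul_mem hp hq, eval_mul⟩

theorem derivation_mem_adjoin {d : Derivation K A A} {S : Set A} {R : Subalgebra K A}
    (hSR : S ⊆ R) (hS : ∀ s ∈ S, d s ∈ R) {x : A} (hx : x ∈ Algebra.adjoin K S) : d x ∈ R := by
  have hle : Algebra.adjoin K S ≤ R := Algebra.adjoin_le hSR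
  induction hx using Algebra.adjoin_induction with
  | mem y hy => exact hS y hy
  | algebraMap r => rw [d.map_algebraMap]; exact R.zero_mem
  | add y z _ _ hy hz => rw [map_add]; exact add_mem hy hz
  | mul y z hy' hz' hy hz =>
    rw [d.leibniz, smul_eq_mul, smul_eq_mul]
    exact add_mem (mul_mem (hle hy') hz) (mul_mem (hle hz') hy)

end DerivationCoefficients

/-! ### Algebraic independence of iterated exponentials -/

section Exponentials

variable {K A : Type*} [Field K] [CommRing A] [IsDomain A] [CharZero A] [Algebra K A]

/-- If an exponential `E` is algebraic over `R`, then some power of `E` is, up to algebraic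
constants, a quotient of elements of `R`. -/
theorem exists_logDeriv_of_isAlgebraic {R : Subalgebra K A} {d : Derivation K A A}
    (hR : ∀ a ∈ R, d a ∈ R) {E g : A} (hE : E ≠ 0) (hg : g ∈ R) (hdE : d E = E * g)
    (halg : IsAlgebraic R E) :
    ∃ a ∈ R, ∃ b ∈ R, ∃ m : ℕ, a ≠ 0 ∧ b ≠ 0 ∧ m ≠ 0 ∧
      a * d b - b * d a = (m : A) * g * a * b := by
  obtain ⟨p, hp, h0, hpE, hmin⟩ := exists_minimal_annihilator halg
  set n := p.natDegree with hn
  have hlc : p.coeff n ≠ 0 := leadingCoeff_ne_zero.2 h0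
  -- The first bracket is the polynomial whose value at `E` is `d (p(E)) = 0`; the multiple of `p`
  -- subtracted cancels its coefficient of degree `n`, so minimality forces `q = 0`.
  set q : A[X] := C (p.coeff n) * (coeffDerivation d p + X * derivative p * C g) -
    C (d (p.coeff n) + n * p.coeff n * g) * p with hq
  have hcoeff : ∀ i, q.coeff i = p.coeff n * (d (p.coeff i) + i * p.coeff i * g) -
      (d (p.coeff n) + n * p.coeff n * g) * p.coeff i := fun i => by
    rw [hq, coeff_sub, coeff_C_mul, coeff_C_mul, coeff_add, coeff_coeffDerivation, coeff_mul_C]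
    rcases i with _ | i
    · simp
    · rw [coeff_X_mul, coeff_derivative]; push_cast; ring
  have hqmem : q ∈ coeffSubalgebra R := by
    refine sub_mem (mul_mem (C_mem_coeffSubalgebra (hp n)) (add_mem (coeffDerivation_mem hR hp)
      (mul_mem (mul_mem (X_mem_coeffSubalgebra R) (derivative_mem_coeffSubalgebra hp))
        (C_mem_coeffSubalgebra hg)))) (mul_mem (C_mem_coeffSubalgebra ?_) hp)
    exact add_mem (hR _ (hp n)) (mul_mem (mul_mem (natCast_mem R n) (hp n)) hg)
  have hqE : q.eval E = 0 := by
    have h := derivation_eval d p E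
    rw [hpE, map_zero, hdE] at h
    simp only [hq, eval_sub, eval_mul, eval_add, eval_C, eval_X, hpE]
    linear_combination (-p.coeff n) * h
  have hq0 : q = 0 := by
    by_contra hne
    refine hne (hmin q hqmem hqE ?_)
    by_contra hlt
    have hle := not_lt.1 hlt
    refine leadingCoeff_ne_zero.2 hne ?_
    rw [leadingCoeff, hcoeff]
    rcases hle.eq_or_lt with h | h
    · rw [← h]; ring
    · rw [coeff_eq_zero_of_natDegree_lt h, map_zero]; ring
  -- A monomial cannot vanish at `E ≠ 0`, so there is a second non-zero coefficient to compare with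
  -- the leading one.
  obtain ⟨i, hin, hi⟩ : ∃ i, i < n ∧ p.coeff i ≠ 0 := by
    by_contra! hall
    have hpm : p = monomial n (p.coeff n) := by
      ext j
      rw [coeff_monomial]
      split_ifs with h
      · rw [h]
      · rcases lt_or_gt_of_ne h with h' | h'
        · exact coeff_eq_zero_of_natDegree_lt h'
        · exact hall j h'
    rw [hpm, eval_monomial] at hpE
    exact mul_ne_zero hlc (pow_ne_zero n hE) hpE
  refine ⟨p.coeff n, hp n, p.coeff i, hp i, n - i, hlc, hi, by omega, ?_⟩
  have h := hcoeff i
  rw [hq0, coeff_zero] at h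
  rw [Nat.cast_sub hin.le]
  linear_combination -h

/-- Compare degrees in `t`: since `d t = t * c`, the derivation does not raise the degree, so the
left side has degree at most `deg a + deg b`, whereas the right side has one more. -/
theorem logDeriv_ne_of_transcendental {S : Set A} {d : Derivation K A A} {t c : A}
    (hR : ∀ a ∈ Algebra.adjoin K S, d a ∈ Algebra.adjoin K S)
    (ht : Transcendental (Algebra.adjoin K S) t) (hc : c ∈ Algebra.adjoin K S) (hc0 : c ≠ 0)
    (hdt : d t = t * c) {a b : A} (ha : a ∈ Algebra.adjoin K (insert t S))
    (hb : b ∈ Algebra.adjoin K (insert t S)) (ha0 : a ≠ 0) (hb0 : b ≠ 0) {m : ℕ} (hm : m ≠ 0) :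
    a * d b - b * d a ≠ (m : A) * (t * c) * a * b := by
  intro heq
  obtain ⟨p, hp, rfl⟩ := mem_adjoin_insert ha
  obtain ⟨q, hq, rfl⟩ := mem_adjoin_insert hb
  have hp0 : p ≠ 0 := fun h => ha0 (by rw [h, eval_zero])
  have hq0 : q ≠ 0 := fun h => hb0 (by rw [h, eval_zero])
  let D : A[X] → A[X] := fun r => coeffDerivation d r + X * derivative r * C c
  have hD : ∀ r : A[X], (D r).eval t = d (r.eval t) := fun r => by
    rw [derivation_eval, hdt]
    simp only [D, eval_add, eval_mul, eval_X, eval_C]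
    ring
  have hDmem : ∀ r ∈ coeffSubalgebra (Algebra.adjoin K S),
      D r ∈ coeffSubalgebra (Algebra.adjoin K S) := fun r hr =>
    add_mem (coeffDerivation_mem hR hr) (mul_mem (mul_mem (X_mem_coeffSubalgebra _)
      (derivative_mem_coeffSubalgebra hr)) (C_mem_coeffSubalgebra hc))
  have hDdeg : ∀ r : A[X], (D r).natDegree ≤ r.natDegree := fun r => by
    refine (natDegree_add_le _ _).trans (max_le (natDegree_coeffDerivation_le d r) ?_)
    refine natDegree_le_iff_coeff_eq_zero.2 fun i hi => ?_
    rw [coeff_mul_C]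
    rcases i with _ | i
    · simp
    · rw [coeff_X_mul, coeff_derivative, coeff_eq_zero_of_natDegree_lt hi]; ring
  have hpoly : p * D q - q * D p = C ((m : A) * c) * X * p * q := by
    rw [← sub_eq_zero]
    by_contra hne
    refine ht (isAlgebraic_subalgebra_iff.2 ⟨_, ?_, hne, ?_⟩)
    · exact sub_mem (sub_mem (mul_mem hp (hDmem q hq)) (mul_mem hq (hDmem p hp)))
        (mul_mem (mul_mem (mul_mem (C_mem_coeffSubalgebra (mul_mem (natCast_mem _ m) hc))
          (X_mem_coeffSubalgebra _)) hp) hq)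
    · simp only [eval_sub, eval_mul, eval_C, eval_X, hD]
      linear_combination heq
  have h1 : (p * D q - q * D p).natDegree ≤ p.natDegree + q.natDegree := by
    refine (natDegree_sub_le _ _).trans (max_le ?_ ?_)
    · exact natDegree_mul_le.trans (by have := hDdeg q; omega)
    · exact natDegree_mul_le.trans (by have := hDdeg p; omega)
  have hmc : (C ((m : A) * c) : A[X]) ≠ 0 :=
    C_ne_zero.2 (mul_ne_zero (Nat.cast_ne_zero.2 hm) hc0)
  rw [hpoly, natDegree_mul (mul_ne_zero (mul_ne_zero hmc X_ne_zero) hp0) hq0,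
    natDegree_mul (mul_ne_zero hmc X_ne_zero) hp0, natDegree_mul hmc X_ne_zero, natDegree_X,
    natDegree_C] at h1
  omega

theorem image_Iio_succ {B : Type*} (e : ℕ → B) (n : ℕ) :
    e '' Set.Iio (n + 1) = insert (e n) (e '' Set.Iio n) := by
  rw [← Set.image_insert_eq]
  congr 1
  ext i
  simp only [Set.mem_Iio, Set.mem_insert_iff]
  omega

/-- The iterated exponentials `e^z, e^(e^z - 1), …` are algebraically independent. -/
theorem transcendental_iterated_exp {d : Derivation K A A} {e : ℕ → A} (he : ∀ n, e n ≠ 0)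
    (hd : ∀ n, d (e n) = e n * ∏ i ∈ Finset.range n, e i) (n : ℕ) :
    Transcendental (Algebra.adjoin K (e '' Set.Iio n)) (e n) := by
  have hmem : ∀ n, ∏ i ∈ Finset.range n, e i ∈ Algebra.adjoin K (e '' Set.Iio n) := fun n =>
    prod_mem fun i hi => Algebra.subset_adjoin ⟨i, Finset.mem_range.1 hi, rfl⟩
  have hclosed : ∀ n, ∀ a ∈ Algebra.adjoin K (e '' Set.Iio n),
      d a ∈ Algebra.adjoin K (e '' Set.Iio n) := fun n a ha => by
    refine derivation_mem_adjoin Algebra.subset_adjoin ?_ ha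
    rintro _ ⟨i, hi, rfl⟩
    rw [hd]
    refine mul_mem (Algebra.subset_adjoin ⟨i, hi, rfl⟩) (prod_mem fun j hj =>
      Algebra.subset_adjoin ⟨j, (Finset.mem_range.1 hj).trans hi, rfl⟩)
  have hne : ∀ n, ∏ i ∈ Finset.range n, e i ≠ 0 := fun n =>
    Finset.prod_ne_zero_iff.2 fun i _ => he i
  induction n with
  | zero =>
    intro halg
    obtain ⟨a, ha, b, hb, m, ha0, hb0, hm, h⟩ :=
      exists_logDeriv_of_isAlgebraic (hclosed 0) (he 0) (hmem 0) (hd 0) halg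
    have hconst : ∀ x ∈ Algebra.adjoin K (e '' Set.Iio 0), d x = 0 := fun x hx => by
      have hS : e '' Set.Iio 0 = ∅ := by simp
      rw [hS, Algebra.adjoin_empty, Algebra.mem_bot] at hx
      obtain ⟨r, rfl⟩ := hx
      exact d.map_algebraMap r
    rw [hconst a ha, hconst b hb, mul_zero, mul_zero, sub_zero] at h
    exact mul_ne_zero (mul_ne_zero (mul_ne_zero (Nat.cast_ne_zero.2 hm) (hne 0)) ha0) hb0 h.symm
  | succ n ih =>
    intro halg
    -- The logarithmic derivative of `e (n + 1)` is `e n` times a non-zero element of the previous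
    -- stage, which is the case excluded by the degree argument.
    obtain ⟨a, ha, b, hb, m, ha0, hb0, hm, h⟩ :=
      exists_logDeriv_of_isAlgebraic (hclosed (n + 1)) (he _) (hmem _) (hd _) halg
    rw [Finset.prod_range_succ, mul_comm (∏ i ∈ Finset.range n, e i)] at h
    rw [image_Iio_succ] at ha hb
    exact logDeriv_ne_of_transcendental (hclosed n) ih (hmem n) (hne n) (hd n) ha hb ha0 hb0 hm h

end Exponentials

/-! ### Relative algebraic closure and rank in the algebraic matroid -/

section AlgebraicClosure

variable (K : Type*) {A : Type*} [Field K] [CommRing A] [IsDomain A] [Algebra K A]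

/-- The elements that are algebraic over the subalgebra generated by `S`. -/
noncomputable def algClosure (S : Set A) : Subalgebra K A :=
  (Subalgebra.algebraicClosure (Algebra.adjoin K S) A).restrictScalars K

variable {K}

theorem mem_algClosure {S : Set A} {x : A} :
    x ∈ algClosure K S ↔ IsAlgebraic (Algebra.adjoin K S) x := Iff.rfl

theorem coe_algClosure (S : Set A) :
    (algClosure K S : Set A) = (AlgebraicIndependent.matroid K A).closure S :=
  AlgebraicIndependent.matroid_closure_eq.symm

theorem adjoin_le_algClosure (S : Set A) : Algebra.adjoin K S ≤ algClosure K S := fun x hx =>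
  isAlgebraic_algebraMap (⟨x, hx⟩ : Algebra.adjoin K S)

theorem subset_algClosure (S : Set A) : S ⊆ algClosure K S :=
  Algebra.subset_adjoin.trans (adjoin_le_algClosure S)

theorem algClosure_mono {S T : Set A} (h : S ⊆ T) : algClosure K S ≤ algClosure K T := by
  rw [← SetLike.coe_subset_coe, coe_algClosure, coe_algClosure]
  exact Matroid.closure_subset_closure _ h

theorem algClosure_le_of_subset {S T : Set A} (h : S ⊆ algClosure K T) :
    algClosure K S ≤ algClosure K T := by
  rw [← SetLike.coe_subset_coe, coe_algClosure, coe_algClosure]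
  rw [coe_algClosure] at h
  exact Matroid.closure_subset_closure_of_subset_closure h

theorem mem_algClosure_of_mul_mem {S : Set A} {x y : A} (hx0 : x ≠ 0)
    (hx : x ∈ algClosure K S) (hxy : x * y ∈ algClosure K S) : y ∈ algClosure K S :=
  IsAlgebraic.of_mul (mem_nonZeroDivisors_of_ne_zero hx0) hx hxy

theorem transcendental_algClosure {S : Set A} {x : A} (hx : x ∉ algClosure K S) :
    Transcendental (algClosure K S) x := fun h => by
  obtain ⟨p, hp, h0, hpx⟩ := isAlgebraic_subalgebra_iff.1 h
  refine hx (algClosure_le_of_subset (S := algClosure K S) subset_rfl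
    (isAlgebraic_subalgebra_iff.2 ⟨p, fun i => Algebra.subset_adjoin (hp i), h0, hpx⟩))

/-- Differentiate `p(x) = 0` for `p` of minimal degree and solve for `d x`; in characteristic zero
minimality gives `p'(x) ≠ 0`. -/
theorem derivation_mem_algClosure [CharZero A] {d : Derivation K A A} {S : Set A}
    (hS : ∀ s ∈ S, d s ∈ algClosure K S) {x : A} (hx : x ∈ algClosure K S) :
    d x ∈ algClosure K S := by
  obtain ⟨p, hp, h0, hpx, hmin⟩ := exists_minimal_annihilator (mem_algClosure.1 hx)
  have hdeg : p.natDegree ≠ 0 := fun h => by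
    rw [natDegree_eq_zero] at h
    obtain ⟨c, rfl⟩ := h
    rw [eval_C] at hpx
    exact h0 (by rw [hpx, C_0])
  have hder : (derivative p).eval x ≠ 0 := fun h =>
    hdeg (Polynomial.derivative_eq_zero.1
      (hmin _ (derivative_mem_coeffSubalgebra hp) h (natDegree_derivative_lt hdeg)))
  have h := derivation_eval d p x
  rw [hpx, map_zero] at h
  have hle := adjoin_le_algClosure (K := K) S
  refine mem_algClosure_of_mul_mem hder
    (eval_mem_of_coeff_mem (fun i => hle (derivative_mem_coeffSubalgebra hp i)) hx) ?_
  rw [show (derivative p).eval x * d x = -(coeffDerivation d p).eval x by linear_combination -h]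
  exact neg_mem (eval_mem_of_coeff_mem
    (fun i => derivation_mem_adjoin (subset_algClosure S) hS (hp i)) hx)

theorem eRk_matroid_le_of_subset_algClosure {S T : Set A} (h : S ⊆ algClosure K T) :
    (AlgebraicIndependent.matroid K A).eRk S ≤ T.encard := by
  rw [coe_algClosure] at h
  exact ((Matroid.eRk_mono _ h).trans_eq (Matroid.eRk_closure_eq _ T)).trans
    (Matroid.eRk_le_encard _ T)

theorem eRk_range_of_algebraicIndependent {k : ℕ} {y : Fin k → A}
    (hy : AlgebraicIndependent K y) :
    (AlgebraicIndependent.matroid K A).eRk (Set.range y) = k := by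
  rw [(AlgebraicIndependent.matroid_indep_iff.2 hy.to_subtype_range).eRk_eq_encard,
    ← Set.image_univ, hy.injective.encard_image]
  simp

theorem encard_range_fin_le {B : Type*} {k : ℕ} (x : Fin k → B) : (Set.range x).encard ≤ k := by
  rw [← Set.image_univ]
  exact (Set.encard_image_le _ _).trans (by simp)

/-- Rank count: the `k` elements `x i` span a flat of rank at least `k`, so they are distinct and
independent. -/
theorem algebraicIndependent_of_mem_algClosure {k : ℕ} {x y : Fin k → A}
    (hy : AlgebraicIndependent K y) (h : ∀ i, y i ∈ algClosure K (Set.range x)) :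
    AlgebraicIndependent K x := by
  have hxy : (AlgebraicIndependent.matroid K A).eRk (Set.range y) ≤
      (AlgebraicIndependent.matroid K A).eRk (Set.range x) := by
    rw [← Matroid.eRk_closure_eq _ (Set.range x), ← coe_algClosure]
    exact Matroid.eRk_mono _ (Set.range_subset_iff.2 h)
  rw [eRk_range_of_algebraicIndependent hy] at hxy
  have hcard : (Set.range x).encard = k :=
    le_antisymm (encard_range_fin_le x) (hxy.trans (Matroid.eRk_le_encard _ _))
  have hinj : Function.Injective x := by
    have h2 : Set.InjOn x Set.univ := by
      refine (Set.finite_univ).injOn_of_encard_image_eq ?_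
      rw [Set.image_univ, hcard]
      simp
    exact Set.injOn_univ.1 h2
  refine AlgebraicIndependent.of_subtype_range hinj (AlgebraicIndependent.matroid_indep_iff.1 ?_)
  rw [Matroid.indep_iff_eRk_eq_encard_of_finite (Set.finite_range x)]
  exact le_antisymm (Matroid.eRk_le_encard _ _) (hcard.trans_le hxy)

theorem not_algebraicIndependent_of_mem_algClosure {S : Set A} {k : ℕ} (hk : S.encard < k)
    {x : Fin k → A} (h : ∀ i, x i ∈ algClosure K S) : ¬ AlgebraicIndependent K x := fun hx =>
  hk.not_ge ((eRk_range_of_algebraicIndependent hx).symm.trans_le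
    (eRk_matroid_le_of_subset_algClosure (Set.range_subset_iff.2 h)))

theorem algebraicIndependent_of_forall_notMem {e : ℕ → A}
    (he : ∀ n, e n ∉ algClosure K (e '' Set.Iio n)) : AlgebraicIndependent K e := by
  have hindep : ∀ n, AlgebraicIndepOn K e (Set.Iio n) := fun n => by
    induction n with
    | zero =>
      have : IsEmpty (Set.Iio 0 : Set ℕ) := ⟨fun i => Nat.not_lt_zero _ i.2⟩
      exact algebraicIndependent_empty_type_iff.2 (algebraMap K A).injective
    | succ n ih =>
      have hins : Set.Iio (n + 1) = insert n (Set.Iio n) := by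
        ext i
        simp only [Set.mem_Iio, Set.mem_insert_iff]
        omega
      rw [hins]
      exact ih.insert (he n)
  refine algebraicIndependent_of_finite_type fun t ht => ?_
  obtain ⟨n, hn⟩ := ht.bddAbove
  exact (hindep (n + 1)).mono fun i hi => Nat.lt_succ_of_le (hn hi)

/-- A finite set can make only finitely many members of an algebraically independent sequence
algebraic over their predecessors. -/
theorem exists_forall_notMem_algClosure {S : Set A} (hS : S.Finite) {e : ℕ → A}
    (he : ∀ n, e n ∉ algClosure K (e '' Set.Iio n)) :
    ∃ N, ∀ n, N ≤ n → e n ∉ algClosure K (S ∪ e '' Set.Iio n) := by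
  set M := AlgebraicIndependent.matroid K A
  by_contra! hbad
  have hindep : ∀ n : ℕ, M.Indep (e '' Set.Iio n) ∧ (e '' Set.Iio n).encard = n := fun n => by
    have h := algebraicIndependent_of_forall_notMem he
    refine ⟨Matroid.Indep.subset (AlgebraicIndependent.matroid_indep_iff.2 h.to_subtype_range)
      (Set.image_subset_range _ _), ?_⟩
    rw [h.injective.encard_image, ← Finset.coe_Iio, Set.encard_coe_eq_coe_finsetCard,
      Nat.card_Iio]
  have hstep : ∀ n, M.eRk (S ∪ e '' Set.Iio (n + 1)) ≤ M.eRk (S ∪ e '' Set.Iio n) + 1 :=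
    fun n => by
      rw [image_Iio_succ, Set.union_insert]
      exact M.eRk_insert_le_add_one _ _
  have hmono : ∀ (c n j : ℕ), M.eRk (S ∪ e '' Set.Iio n) + c ≤ S.encard + n →
      M.eRk (S ∪ e '' Set.Iio (n + j)) + c ≤ S.encard + (n + j : ℕ) := fun c n j hn => by
    induction j with
    | zero => exact hn
    | succ j ih =>
      calc M.eRk (S ∪ e '' Set.Iio (n + j + 1)) + c
          ≤ M.eRk (S ∪ e '' Set.Iio (n + j)) + 1 + c := by gcongr; exact hstep _
        _ = M.eRk (S ∪ e '' Set.Iio (n + j)) + c + 1 := by ring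
        _ ≤ S.encard + (n + j : ℕ) + 1 := by gcongr
        _ = S.encard + (n + (j + 1) : ℕ) := by push_cast; ring
  -- Each bad index adds one to the deficit of the rank below `|S| + n`. The rank is at least `n`,
  -- so a deficit of `|S| + 1` is impossible.
  have hdrop : ∀ c : ℕ, ∃ n : ℕ, M.eRk (S ∪ e '' Set.Iio n) + c ≤ S.encard + n := fun c => by
    induction c with
    | zero =>
      refine ⟨0, ?_⟩
      simpa using M.eRk_le_encard S
    | succ c ih =>
      obtain ⟨n, hn⟩ := ih
      obtain ⟨m, hnm, hm⟩ := hbad n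
      obtain ⟨j, rfl⟩ := Nat.exists_eq_add_of_le hnm
      refine ⟨n + j + 1, ?_⟩
      rw [← SetLike.mem_coe, coe_algClosure] at hm
      have heq : M.eRk (S ∪ e '' Set.Iio (n + j + 1)) = M.eRk (S ∪ e '' Set.Iio (n + j)) := by
        rw [image_Iio_succ, Set.union_insert, ← M.eRk_insert_closure_eq,
          Set.insert_eq_of_mem hm, M.eRk_closure_eq]
      rw [heq]
      calc M.eRk (S ∪ e '' Set.Iio (n + j)) + ((c + 1 : ℕ) : ℕ∞)
          = M.eRk (S ∪ e '' Set.Iio (n + j)) + c + 1 := by push_cast; ring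
        _ ≤ S.encard + (n + j : ℕ) + 1 := add_le_add (hmono c n j hn) le_rfl
        _ = S.encard + (n + j + 1 : ℕ) := by push_cast; ring
  obtain ⟨n, hn⟩ := hdrop (S.ncard + 1)
  have hle : (n : ℕ∞) ≤ M.eRk (S ∪ e '' Set.Iio n) := by
    rw [← (hindep n).2, ← (hindep n).1.eRk_eq_encard]
    exact M.eRk_mono Set.subset_union_right
  have h := (add_le_add_left hle _).trans hn
  rw [← hS.cast_ncard_eq] at h
  norm_cast at h
  omega

end AlgebraicClosure

/-! ### Independence via leading homogeneous forms -/

section LeadingForms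

theorem prod_linear_coeff {ι A : Type*} [CommRing A] (s : Finset ι) (b p : ι → A) (m : ι → ℕ) :
    (∏ i ∈ s, (C (b i) + X * C (p i)) ^ m i).natDegree ≤ ∑ i ∈ s, m i ∧
      (∏ i ∈ s, (C (b i) + X * C (p i)) ^ m i).coeff (∑ i ∈ s, m i) = ∏ i ∈ s, p i ^ m i := by
  classical
  have hlin : ∀ i, (C (b i) + X * C (p i)).natDegree ≤ 1 := fun i => by
    rw [add_comm, mul_comm]
    exact natDegree_linear_le
  have hpow : ∀ i, ((C (b i) + X * C (p i)) ^ m i).natDegree ≤ m i := fun i =>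
    (natDegree_pow_le_of_le (m i) (hlin i)).trans (by simp)
  induction s using Finset.induction_on with
  | empty => simp
  | insert i s hi ih =>
    rw [Finset.prod_insert hi, Finset.sum_insert hi, Finset.prod_insert hi]
    refine ⟨natDegree_mul_le_of_le (hpow i) ih.1, ?_⟩
    rw [coeff_mul_add_eq_of_natDegree_le (hpow i) ih.1, ih.2]
    congr 1
    have := coeff_pow_of_natDegree_le (m := m i) (hlin i)
    rw [mul_one] at this
    rw [this]
    simp

theorem coeff_aeval_linear {K A : Type*} [Field K] [CommRing A] [Algebra K A] {k n : ℕ} (b p : Fin k → A) {Q : MvPolynomial (Fin k) K}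
    (hQ : Q.totalDegree ≤ n) :
    (MvPolynomial.aeval (fun i => C (b i) + X * C (p i)) Q).coeff n =
      MvPolynomial.aeval p (MvPolynomial.homogeneousComponent n Q) := by
  rw [MvPolynomial.homogeneousComponent_apply, map_sum, Finset.sum_filter]
  conv_lhs => rw [Q.as_sum]
  rw [map_sum, finsetSum_coeff]
  refine Finset.sum_congr rfl fun m hm => ?_
  have hdeg : m.degree ≤ n := by
    refine le_trans ?_ hQ
    have := MvPolynomial.le_totalDegree hm
    rwa [Finsupp.sum_fintype _ _ (by simp), ← Finsupp.degree_eq_sum] at this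
  rw [MvPolynomial.aeval_monomial, Finsupp.prod_fintype _ _ (by simp),
    IsScalarTower.algebraMap_apply K A A[X], Polynomial.algebraMap_apply, coeff_C_mul]
  obtain ⟨h1, h2⟩ := prod_linear_coeff Finset.univ b p m
  rw [← Finsupp.degree_eq_sum] at h1 h2
  split_ifs with h
  · rw [MvPolynomial.aeval_monomial, Finsupp.prod_fintype _ _ (by simp), ← h, h2]
    rfl
  · rw [coeff_eq_zero_of_natDegree_lt (h1.trans_lt (lt_of_le_of_ne hdeg h)), mul_zero]

variable {K A : Type*} [Field K] [CommRing A] [Algebra K A]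

theorem tail_injOn_degree {k n : ℕ} {m m' : Fin (k + 1) →₀ ℕ} (hm : m.degree = n)
    (hm' : m'.degree = n) (h : m.tail = m'.tail) : m = m' := by
  have h1 : ∀ l : Fin (k + 1) →₀ ℕ, l.degree = l 0 + l.tail.degree := fun l => by
    rw [Finsupp.degree_eq_sum, Finsupp.degree_eq_sum, Fin.sum_univ_succ]
    simp [Finsupp.tail_apply]
  have h0 : m 0 = m' 0 := by
    have := h1 m
    have := h1 m'
    rw [h] at *
    omega
  rw [← Finsupp.cons_tail m, ← Finsupp.cons_tail m', h, h0]

/-- Dehomogenise by setting the variable `0` to `1`. In a fixed degree this loses no monomial, and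
independence of the other `p i` kills the result. -/
theorem homogeneous_eq_zero_of_aeval {k n : ℕ} {p : Fin (k + 1) → A} (hp0 : p 0 = 1)
    (hp : AlgebraicIndependent K fun i : Fin k => p i.succ)
    {Q : MvPolynomial (Fin (k + 1)) K} (hQ : Q.IsHomogeneous n)
    (h : MvPolynomial.aeval p Q = 0) : Q = 0 := by
  have hmono : ∀ m : Fin (k + 1) →₀ ℕ, MvPolynomial.aeval (Fin.cons 1 MvPolynomial.X :
      Fin (k + 1) → MvPolynomial (Fin k) K) (MvPolynomial.monomial m (1 : K)) =
      MvPolynomial.monomial m.tail 1 := fun m => by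
    rw [MvPolynomial.aeval_monomial, map_one, one_mul, Finsupp.prod_fintype _ _ (by simp),
      Fin.prod_univ_succ, MvPolynomial.monomial_eq, Finsupp.prod_fintype _ _ (by simp)]
    simp [Finsupp.tail_apply]
  set G := MvPolynomial.aeval (Fin.cons 1 MvPolynomial.X :
      Fin (k + 1) → MvPolynomial (Fin k) K) Q with hG
  have hGsum : G = ∑ m ∈ Q.support, MvPolynomial.monomial m.tail (Q.coeff m) := by
    conv_lhs => rw [hG, Q.as_sum, map_sum]
    refine Finset.sum_congr rfl fun m _ => ?_
    rw [← mul_one (Q.coeff m), ← smul_eq_mul, ← MvPolynomial.smul_monomial, map_smul, hmono,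
      MvPolynomial.smul_monomial]
  have hG0 : G = 0 := by
    refine (algebraicIndependent_iff.1 hp) G ?_
    rw [← h, hG, ← AlgHom.comp_apply]
    congr 1
    ext i
    refine Fin.cases ?_ (fun i => ?_) i
    · simp [hp0]
    · simp
  ext m
  rw [MvPolynomial.coeff_zero]
  by_contra hm
  have hdeg : ∀ l ∈ Q.support, l.degree = n := fun l hl => by
    have := hQ (MvPolynomial.mem_support_iff.1 hl)
    rwa [show l.degree = Finsupp.weight 1 l from
      DFunLike.congr_fun Finsupp.degree_eq_weight_one l]
  have hms := MvPolynomial.mem_support_iff.2 hm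
  have hc := congrArg (MvPolynomial.coeff m.tail) (hGsum.symm.trans hG0)
  rw [MvPolynomial.coeff_zero, MvPolynomial.coeff_sum, Finset.sum_eq_single m] at hc
  · rw [MvPolynomial.coeff_monomial, if_pos rfl] at hc
    exact hm hc
  · intro l hl hlm
    rw [MvPolynomial.coeff_monomial, if_neg]
    exact fun ht => hlm (tail_injOn_degree (hdeg l hl) (hdeg m hms) ht)
  · exact fun h => (h hms).elim

/-- In a relation `Q(b + u p) = 0` every coefficient of a power of `u` vanishes. The coefficient at
the total degree of `Q` is its top form evaluated at `p`, so the top form is zero. -/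
theorem algebraicIndependent_linear [IsDomain A] {k : ℕ} {R : Subalgebra K A} {u : A}
    (hu : Transcendental R u) {b p : Fin (k + 1) → A} (hb : ∀ i, b i ∈ R) (hpR : ∀ i, p i ∈ R)
    (hp0 : p 0 = 1) (hp : AlgebraicIndependent K fun i : Fin k => p i.succ) :
    AlgebraicIndependent K fun i => b i + u * p i := by
  rw [algebraicIndependent_iff]
  intro Q hQ
  set W : A[X] := MvPolynomial.aeval (fun i => C (b i) + X * C (p i)) Q with hW
  have hWmem : W ∈ coeffSubalgebra R := by
    have hle : Algebra.adjoin K (Set.range fun i => C (b i) + X * C (p i)) ≤ coeffSubalgebra R := by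
      refine Algebra.adjoin_le ?_
      rintro _ ⟨i, rfl⟩
      exact add_mem (C_mem_coeffSubalgebra (hb i))
        (mul_mem (X_mem_coeffSubalgebra R) (C_mem_coeffSubalgebra (hpR i)))
    apply hle
    rw [Algebra.adjoin_range_eq_range_aeval]
    exact ⟨Q, rfl⟩
  have hWu : W.eval u = 0 := by
    rw [← hQ, hW, ← coe_aeval_eq_eval]
    change (((aeval u).restrictScalars K).comp (MvPolynomial.aeval _)) Q = _
    congr 1
    ext i
    simp [mul_comm u]
  have hW0 : W = 0 := by
    by_contra h
    exact hu (isAlgebraic_subalgebra_iff.2 ⟨W, hWmem, h, hWu⟩)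
  have htop : MvPolynomial.homogeneousComponent Q.totalDegree Q = 0 := by
    refine homogeneous_eq_zero_of_aeval hp0 hp
      (MvPolynomial.homogeneousComponent_isHomogeneous _ Q) ?_
    rw [← coeff_aeval_linear b p le_rfl, ← hW, hW0, coeff_zero]
  by_contra hQ0
  obtain ⟨m, hm, hmdeg⟩ := Finset.exists_mem_eq_sup Q.support
    (MvPolynomial.support_nonempty.2 hQ0) fun m => m.sum fun _ e => e
  refine MvPolynomial.mem_support_iff.1 hm ?_
  have hc := congrArg (MvPolynomial.coeff m) htop
  rwa [MvPolynomial.coeff_homogeneousComponent, if_pos, MvPolynomial.coeff_zero] at hc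
  rw [MvPolynomial.totalDegree, hmdeg, Finsupp.sum_fintype _ _ (by simp), Finsupp.degree_eq_sum]

end LeadingForms

end IterLog

namespace IterLog

/-! ### Jets along the exponential tower, and the main contradiction -/

section Jets

variable {K A : Type*} [Field K] [CommRing A] [Algebra K A]

/-- The cofactors `p_i` with `d^i u = u * p_i` for an element `u` with `d u = u * s`. -/
def expCofactor (d : Derivation K A A) (s : A) : ℕ → A
  | 0 => 1
  | i + 1 => d (expCofactor d s i) + s * expCofactor d s i

theorem iterate_derivation_exp {d : Derivation K A A} {u s : A} (hu : d u = u * s) (i : ℕ) :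
    d^[i] u = u * expCofactor d s i := by
  induction i with
  | zero => simp [expCofactor]
  | succ i ih =>
    rw [Function.iterate_succ_apply', ih, d.leibniz, hu, expCofactor, smul_eq_mul, smul_eq_mul]
    ring

theorem expCofactor_mem {R : Subalgebra K A} {d : Derivation K A A} (hR : ∀ a ∈ R, d a ∈ R)
    {s : A} (hs : s ∈ R) (i : ℕ) : expCofactor d s i ∈ R := by
  induction i with
  | zero => exact R.one_mem
  | succ i ih => exact add_mem (hR _ ih) (mul_mem hs ih)

theorem iterate_derivation_mem {R : Subalgebra K A} {d : Derivation K A A}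
    (hR : ∀ a ∈ R, d a ∈ R) {s : A} (hs : s ∈ R) (i : ℕ) : d^[i] s ∈ R := by
  induction i with
  | zero => exact hs
  | succ i ih =>
    rw [Function.iterate_succ_apply']
    exact hR _ ih

/-- Triangularity of the cofactors with respect to the jets of `s`, so that independence passes from
the jets to the cofactors of positive index. -/
theorem expCofactor_sub_mem (d : Derivation K A A) (s : A) (i : ℕ) :
    expCofactor d s (i + 1) - d^[i] s ∈
      Algebra.adjoin K ((fun j => d^[j] s) '' Set.Iio i) := by
  induction i with
  | zero => simp [expCofactor]
  | succ i ih =>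
    set R := Algebra.adjoin K ((fun j => d^[j] s) '' Set.Iio (i + 1)) with hR
    have hjet : ∀ j, j < i + 1 → d^[j] s ∈ R := fun j hj => Algebra.subset_adjoin ⟨j, hj, rfl⟩
    have hle : Algebra.adjoin K ((fun j => d^[j] s) '' Set.Iio i) ≤ R :=
      Algebra.adjoin_mono (Set.image_mono (Set.Iio_subset_Iio i.le_succ))
    have hd : d (expCofactor d s (i + 1) - d^[i] s) ∈ R := by
      refine derivation_mem_adjoin (R := R) (Algebra.subset_adjoin.trans hle) ?_ ih
      rintro _ ⟨j, hj, rfl⟩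
      rw [← Function.iterate_succ_apply' (⇑d)]
      exact hjet _ (Nat.succ_lt_succ hj)
    have hp : expCofactor d s (i + 1) ∈ R := by
      have := add_mem (hle ih) (hjet i i.lt_succ_self)
      rwa [sub_add_cancel] at this
    rw [map_sub, ← Function.iterate_succ_apply' (⇑d)] at hd
    have := add_mem hd (mul_mem (hjet 0 i.succ_pos) hp)
    rw [expCofactor]
    convert this using 1
    simp only [Function.iterate_zero, id]
    ring

theorem iterate_exp_derivation {d : Derivation K A A} {φ : A →ₐ[K] A} {e : A}
    (hφ : ∀ a, d (φ a) = e * φ (d a)) (hde : d e = e) (n : ℕ) :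
    d (φ^[n] e) = φ^[n] e * ∏ i ∈ Finset.range n, φ^[i] e := by
  induction n with
  | zero => simpa using hde
  | succ n ih =>
    rw [Function.iterate_succ_apply', hφ, ih, map_mul, map_prod, Finset.prod_range_succ']
    simp only [← Function.iterate_succ_apply' (⇑φ), Function.iterate_zero, id]
    ring

variable [IsDomain A]

theorem algebraicIndependent_expCofactor {d : Derivation K A A} {s : A} {k : ℕ}
    (h : AlgebraicIndependent K fun i : Fin k => d^[i] s) :
    AlgebraicIndependent K fun i : Fin k => expCofactor d s (i + 1) := by
  refine algebraicIndependent_of_mem_algClosure h fun i => adjoin_le_algClosure _ ?_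
  obtain ⟨i, hi⟩ := i
  change d^[i] s ∈ _
  induction i using Nat.strong_induction_on with
  | _ i ih =>
    have h1 : expCofactor d s (i + 1) ∈
        Algebra.adjoin K (Set.range fun i : Fin k => expCofactor d s (i + 1)) :=
      Algebra.subset_adjoin ⟨⟨i, hi⟩, rfl⟩
    have h2 : Algebra.adjoin K ((fun j => d^[j] s) '' Set.Iio i) ≤
        Algebra.adjoin K (Set.range fun i : Fin k => expCofactor d s (i + 1)) := by
      refine Algebra.adjoin_le ?_
      rintro _ ⟨j, hj, rfl⟩
      exact ih j hj (lt_trans hj hi)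
    have := sub_mem h1 (h2 (expCofactor_sub_mem d s i))
    rwa [sub_sub_cancel] at this

/-- A tower of exponentials, each transcendental over the previous stage: the sums `s k` and the
exponentials `u k` have algebraically independent jets, of a length that grows with `k`. -/
theorem algebraicIndependent_jets {d : Derivation K A A} {F : ℕ → Subalgebra K A} {u s : ℕ → A}
    (hF : ∀ k, ∀ a ∈ F k, d a ∈ F k) (hs : ∀ k, s k ∈ F k)
    (hu : ∀ k, Transcendental (F k) (u k)) (hsu : ∀ k, s (k + 1) = s k + u k)
    (hdu : ∀ k, d (u k) = u k * s k) (k : ℕ) :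
    (AlgebraicIndependent K fun i : Fin k => d^[i] (s k)) ∧
      AlgebraicIndependent K fun i : Fin (k + 1) => d^[i] (u k) := by
  -- Used with `b` the jets of `s k`, which gives the jets of `s (k + 1)`, and with `b = 0`, which
  -- gives those of `u k`.
  have key : ∀ k, (AlgebraicIndependent K fun i : Fin k => d^[i] (s k)) → ∀ b : Fin (k + 1) → A,
      (∀ i, b i ∈ F k) →
        AlgebraicIndependent K fun i : Fin (k + 1) => b i + u k * expCofactor d (s k) i :=
    fun k h b hb => algebraicIndependent_linear (p := fun i : Fin (k + 1) => expCofactor d (s k) i)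
      (hu k) hb (fun i => expCofactor_mem (hF k) (hs k) i) rfl (algebraicIndependent_expCofactor h)
  have hjets : ∀ k, AlgebraicIndependent K fun i : Fin k => d^[i] (s k) := fun k => by
    induction k with
    | zero =>
      rw [algebraicIndependent_empty_type_iff]
      exact (algebraMap K A).injective
    | succ k ih =>
      convert key k ih (fun i => d^[i] (s k)) fun i => iterate_derivation_mem (hF k) (hs k) i
        using 2 with i
      rw [← iterate_derivation_exp (hdu k), hsu, iterate_map_add]
  refine ⟨hjets k, ?_⟩
  convert key k (hjets k) (fun _ => 0) (fun _ => zero_mem _) using 2 with i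
  rw [← iterate_derivation_exp (hdu k), zero_add]

variable [CharZero A]

/-- A non-zero solution `h` of Julia's equation for `e^z - 1` is not contained in a differential
ring of finite transcendence degree. -/
theorem not_mem_algClosure_of_julia {d : Derivation K A A} {φ : A →ₐ[K] A} {e h : A}
    (hφ : ∀ a, d (φ a) = e * φ (d a)) (hφh : φ h = e * h) (hde : d e = e)
    (he : ∀ n, φ^[n] e ≠ 0) (hh : h ≠ 0) {S : Set A} (hS : S.Finite)
    (hSd : ∀ s ∈ S, d s ∈ algClosure K S) : h ∉ algClosure K S := by
  intro hhS
  have hdexp := iterate_exp_derivation hφ hde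
  obtain ⟨N, hN⟩ := exists_forall_notMem_algClosure (K := K) hS (e := fun n => φ^[n] e)
    fun n => transcendental_iterated_exp he hdexp n
  set T : ℕ → Subalgebra K A := fun n => algClosure K (S ∪ (fun n => φ^[n] e) '' Set.Iio n)
    with hT
  have hTmono : Monotone T := fun m n hmn =>
    algClosure_mono (Set.union_subset_union_right _ (Set.image_mono (Set.Iio_subset_Iio hmn)))
  have hTe : ∀ n i, i < n → φ^[i] e ∈ T n := fun n i hi =>
    subset_algClosure _ (Or.inr ⟨i, hi, rfl⟩)
  have hST : ∀ n, algClosure K S ≤ T n := fun n => algClosure_mono Set.subset_union_left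
  have hTd : ∀ n, ∀ a ∈ T n, d a ∈ T n := fun n a ha => by
    refine derivation_mem_algClosure ?_ ha
    rintro _ (hs | ⟨i, hi, rfl⟩)
    · exact hST n (hSd _ hs)
    · change d (φ^[i] e) ∈ _
      rw [hdexp]
      exact mul_mem (hTe n i hi) (prod_mem fun j hj =>
        hTe n j ((Finset.mem_range.1 hj).trans hi))
  set v : ℕ → A := fun n => φ^[n] h with hv
  have hvsucc : ∀ n, v (n + 1) = φ^[n] e * v n := fun n => by
    simp only [hv]
    rw [Function.iterate_succ_apply, hφh, iterate_map_mul]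
  have hvprod : ∀ n, v n = h * ∏ i ∈ Finset.range n, φ^[i] e := fun n => by
    induction n with
    | zero => simp [hv]
    | succ n ih => rw [hvsucc, ih, Finset.prod_range_succ]; ring
  have hvne : ∀ n, v n ≠ 0 := fun n => by
    rw [hvprod]
    exact mul_ne_zero hh (Finset.prod_ne_zero_iff.2 fun i _ => he i)
  have hvT : ∀ n, v n ∈ T n := fun n => by
    rw [hvprod]
    exact mul_mem (hST n hhS) (prod_mem fun j hj => hTe n j (Finset.mem_range.1 hj))
  set s : ℕ → A := fun n => d h + ∑ j ∈ Finset.range n, v j with hs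
  have hsT : ∀ n, s (n + 1) ∈ T n := fun n =>
    add_mem (hTd n _ (hST n hhS)) (sum_mem fun j hj =>
      hTmono (Nat.lt_succ_iff.1 (Finset.mem_range.1 hj)) (hvT j))
  have hssucc : ∀ n, s (n + 1) = s n + v n := fun n => by
    simp only [hs]
    rw [Finset.sum_range_succ, add_assoc]
  have hdv : ∀ n, (h • d) (v n) = v n * s n := fun n => by
    induction n with
    | zero => simp [hv, hs]
    | succ n ih =>
      have h1 : h * d (φ^[n] e) = v (n + 1) := by
        rw [hdexp, hvsucc, hvprod]
        ring
      rw [Derivation.smul_apply, smul_eq_mul] at ih ⊢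
      rw [hssucc, hvsucc, d.leibniz, smul_eq_mul, smul_eq_mul]
      rw [hvsucc] at h1
      linear_combination φ^[n] e * ih + v n * h1
  -- The quotient of `v (n + 1)` by `v n ∈ T n` is the new exponential, which is not in `T n`.
  have hvtrans : ∀ n, N ≤ n → Transcendental (T n) (v (n + 1)) := fun n hn => by
    refine transcendental_algClosure fun hmem => hN n hn ?_
    refine mem_algClosure_of_mul_mem (hvne n) (hvT n) ?_
    rwa [mul_comm, ← hvsucc]
  have hjets := (algebraicIndependent_jets (d := h • d) (F := fun k => T (N + k))
    (u := fun k => v (N + k + 1)) (s := fun k => s (N + k + 1))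
    (fun k a ha => mul_mem (hST _ hhS) (hTd _ a ha)) (fun k => hsT _)
    (fun k => hvtrans _ (Nat.le_add_right N k))
    (fun k => hssucc _) (fun k => hdv _) S.ncard).2
  have hcomm : Function.Commute (⇑(h • d)) φ := fun a => by
    simp only [Derivation.smul_apply, smul_eq_mul, hφ, map_mul, hφh]
    ring
  -- Since `φ` commutes with `h • d`, the independent jets of `v (N + S.ncard + 1)` are images of
  -- those of `h`, and independence pulls back along `φ`.
  refine not_algebraicIndependent_of_mem_algClosure (K := K) (S := S) (k := S.ncard + 1)
    (x := fun i => (h • d)^[i] h) ?_ (fun i => ?_)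
    (AlgebraicIndependent.of_comp (φ ^ (N + S.ncard + 1)) ?_)
  · rw [← hS.cast_ncard_eq]
    exact_mod_cast Nat.lt_succ_self _
  · refine iterate_derivation_mem (fun a ha => mul_mem hhS ?_) hhS i
    exact derivation_mem_algClosure hSd ha
  · convert hjets using 2 with i
    rw [Function.comp_apply, AlgHom.coe_pow]
    exact ((hcomm.iterate_iterate i (N + S.ncard + 1)).eq h).symm

end Jets

/-! ### From differential equations to finite transcendence degree -/

section PowerSeries

open PowerSeries

variable {K : Type*} [Field K]

/-- Prepend `z` to the jets of `h`, absorbing the coefficients in `K[z]`. A differential equation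
makes some term algebraic over its predecessors; these predecessors form `S`. -/
theorem exists_finite_of_differentiallyAlgebraic {h : PowerSeries K}
    (hda : DifferentiallyAlgebraic h) :
    ∃ S : Set (PowerSeries K), S.Finite ∧ (∀ s ∈ S, derivative K s ∈ algClosure K S) ∧
      h ∈ algClosure K S := by
  obtain ⟨P, hP0, hP⟩ := hda
  set g : ℕ → PowerSeries K := fun n => Nat.casesOn n X fun i => (derivative K)^[i] h
  have hg0 : g 0 = X := rfl
  have hgs : ∀ i, g (i + 1) = (derivative K)^[i] h := fun _ => rfl
  have hdep : ¬ AlgebraicIndependent K g := fun hind => by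
    have hinj : Function.Injective fun o : Option ℕ => o.elim 0 Nat.succ := by
      rintro (_ | i) (_ | j) hij <;> simp_all
    have hopt := hind.comp _ hinj
    have heval : ∀ Q : MvPolynomial (Option ℕ) K,
        MvPolynomial.aeval (fun n : ℕ => (derivative K)^[n] h)
          (MvPolynomial.optionEquivRight K ℕ Q) =
        MvPolynomial.aeval (g ∘ fun o : Option ℕ => o.elim 0 Nat.succ) Q := fun Q => by
      induction Q using MvPolynomial.induction_on with
      | C a =>
        rw [MvPolynomial.optionEquivRight_C, MvPolynomial.aeval_C, MvPolynomial.aeval_C,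
          PowerSeries.algebraMap_apply', Polynomial.coe_C]
        simp
      | add p q hp hq => simp only [map_add, hp, hq]
      | mul_X p o hp =>
        rw [map_mul, map_mul, map_mul, hp, MvPolynomial.aeval_X]
        congr 1
        rcases o with _ | i
        · rw [MvPolynomial.optionEquivRight_X_none, MvPolynomial.aeval_C,
            PowerSeries.algebraMap_apply', Polynomial.coe_X]
          simp [hg0]
        · rw [MvPolynomial.optionEquivRight_X_some, MvPolynomial.aeval_X]
          simp [hgs]
    refine hP0 ?_
    rw [← (MvPolynomial.optionEquivRight K ℕ).apply_symm_apply P] at hP ⊢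
    rw [heval] at hP
    rw [(algebraicIndependent_iff.1 hopt) _ hP, map_zero]
  obtain ⟨r, hr⟩ : ∃ r, g r ∈ algClosure K (g '' Set.Iio r) := by
    by_contra! hall
    exact hdep (algebraicIndependent_of_forall_notMem hall)
  have hmem : ∀ i, i ≤ r → g i ∈ algClosure K (g '' Set.Iio r) := fun i hi => by
    rcases hi.eq_or_lt with rfl | hlt
    · exact hr
    · exact subset_algClosure _ ⟨i, hlt, rfl⟩
  refine ⟨g '' Set.Iio r, (Set.finite_Iio r).image g, ?_, ?_⟩
  · rintro _ ⟨i, hi, rfl⟩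
    rcases i with _ | i
    · rw [hg0, derivative_X]
      exact one_mem _
    · rw [hgs, ← Function.iterate_succ_apply' (⇑(derivative K))]
      exact hmem (i + 2) (Nat.succ_le_of_lt hi)
  -- The index `0` is impossible, since `z` is transcendental over `K`; hence `h = g 1` is covered
  -- by `hmem`.
  · rcases Nat.eq_zero_or_pos r with rfl | hpos
    · exfalso
      have hX : IsAlgebraic (Algebra.adjoin K (∅ : Set (PowerSeries K))) (X : PowerSeries K) := by
        rwa [show g '' Set.Iio 0 = ∅ by simp] at hr
      rw [Algebra.adjoin_empty] at hX
      obtain ⟨p, hp, hp0, hpX⟩ := isAlgebraic_subalgebra_iff.1 hX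
      have hconst : ∀ i, ∃ c : K, PowerSeries.C c = p.coeff i := fun i => hp i
      choose c hc using hconst
      refine hp0 (Polynomial.ext fun i => ?_)
      rw [← hc, Polynomial.coeff_zero]
      have hsum := congrArg (PowerSeries.coeff i) hpX
      rw [Polynomial.eval_eq_sum_range, map_sum, map_zero] at hsum
      simp_rw [← hc, coeff_C_mul, coeff_X_pow] at hsum
      by_cases hi : i ≤ p.natDegree
      · simp only [mul_ite, mul_one, mul_zero, Finset.sum_ite_eq, Finset.mem_range,
          Nat.lt_succ_of_le hi, if_true] at hsum
        rw [hsum, map_zero]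
      · rw [hc, Polynomial.coeff_eq_zero_of_natDegree_lt (not_le.1 hi)]
    · exact hmem 1 hpos

variable [CharZero K]

theorem hasSubst_exp_sub_one : HasSubst (exp K - 1 : PowerSeries K) :=
  HasSubst.of_constantCoeff_zero' (by simp)

/-- Non-zero solutions of Julia's equation for `e^z - 1` are differentially transcendental. -/
theorem differentiallyTranscendental_of_julia {h : PowerSeries K} (hh : h ≠ 0)
    (hJ : h.subst (exp K - 1 : PowerSeries K) = exp K * h) : DifferentiallyTranscendental h := by
  intro hda
  have : CharZero (PowerSeries K) :=
    charZero_of_injective_algebraMap (algebraMap K (PowerSeries K)).injective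
  obtain ⟨S, hS, hSd, hhS⟩ := exists_finite_of_differentiallyAlgebraic hda
  have hsub := hasSubst_exp_sub_one (K := K)
  refine not_mem_algClosure_of_julia (d := derivative K) (φ := substAlgHom hsub) (e := exp K)
    (fun a => ?_) ?_ (derivative_exp K) (fun n => ?_) hh hS hSd hhS
  · rw [coe_substAlgHom, derivative_subst hsub, map_sub, derivative_exp K]
    simp [mul_comm]
  · rw [coe_substAlgHom, hJ]
  · have hunit : IsUnit ((substAlgHom hsub)^[n] (exp K)) := by
      induction n with
      | zero => exact isUnit_iff_constantCoeff.2 (by simp)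
      | succ n ih =>
        rw [Function.iterate_succ_apply']
        exact ih.map (substAlgHom hsub)
    exact hunit.ne_zero

end PowerSeries

/-! ### Derivative of falling factorials at zero -/

section DescPochhammer

variable {K : Type*} [Field K]

theorem eval_neg_one_descPochhammer (n : ℕ) :
    (descPochhammer K n).eval (-1) = (-1) ^ n * n.factorial := by
  induction n with
  | zero => simp
  | succ n ih =>
    rw [descPochhammer_succ_right, Polynomial.eval_mul, ih, Nat.factorial_succ]
    simp only [Polynomial.eval_sub, Polynomial.eval_X, Polynomial.eval_natCast]
    push_cast
    ring

theorem eval_zero_derivative_descPochhammer (n : ℕ) :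
    (Polynomial.derivative (descPochhammer K (n + 1))).eval 0 = (-1) ^ n * n.factorial := by
  rw [descPochhammer_succ_left, Polynomial.derivative_mul, Polynomial.eval_add,
    Polynomial.eval_mul, Polynomial.eval_mul, Polynomial.eval_comp]
  simp [eval_neg_one_descPochhammer]

end DescPochhammer

/-! ### The logarithm of a substitution as a derivation -/

section Logarithm

open PowerSeries

variable {K : Type*} [Field K]

/-- A derivation of the power series ring is determined by its value at the variable. -/
theorem derivation_eq_zero_of_X (δ : Derivation K (PowerSeries K) (PowerSeries K)) (h : δ X = 0) :
    δ = 0 := by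
  have hn : ∀ (n : ℕ) (g : PowerSeries K), coeff n (δ g) = 0 := fun n => by
    have hg : ∀ g : PowerSeries K, ∃ r, δ g = X * δ r := fun g => by
      obtain ⟨r, hr⟩ := X_dvd_iff.2 (show constantCoeff (g - C (constantCoeff g)) = 0 by simp)
      refine ⟨r, ?_⟩
      have hC : δ (C (constantCoeff g)) = 0 := δ.map_algebraMap (constantCoeff g)
      have := congrArg δ hr
      rw [map_sub, hC, sub_zero, δ.leibniz, h, smul_zero, add_zero, smul_eq_mul] at this
      exact this
    induction n with
    | zero =>
      intro g
      obtain ⟨r, hr⟩ := hg g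
      rw [hr, coeff_zero_X_mul]
    | succ n ih =>
      intro g
      obtain ⟨r, hr⟩ := hg g
      rw [hr, coeff_succ_X_mul, ih]
  ext g n
  rw [hn]
  simp

/-- The operator `φ - 1` for a substitution `φ`. -/
noncomputable def shiftDiff (φ : PowerSeries K →ₐ[K] PowerSeries K) :
    Module.End K (PowerSeries K) :=
  φ.toLinearMap - 1

variable {φ : PowerSeries K →ₐ[K] PowerSeries K}

theorem shiftDiff_apply (g : PowerSeries K) : shiftDiff φ g = φ g - g := rfl

/-- `φ - 1` raises the order by at least one; this makes all the operator series finite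
coefficientwise. -/
theorem X_pow_dvd_shiftDiff (hφ : X ^ 2 ∣ φ X - X) {m : ℕ} {g : PowerSeries K} (hg : X ^ m ∣ g) :
    X ^ (m + 1) ∣ shiftDiff φ g := by
  obtain ⟨b, rfl⟩ := hg
  obtain ⟨c, hc⟩ := hφ
  obtain ⟨r, hr⟩ := X_dvd_iff.2 (show constantCoeff (b - C (constantCoeff b)) = 0 by simp)
  have hC : φ (C (constantCoeff b)) = C (constantCoeff b) := φ.commutes (constantCoeff b)
  have hX : φ X = X * (1 + X * c) := by linear_combination hc
  have hb : φ b - b = X * ((1 + X * c) * φ r - r) := by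
    have := congrArg φ hr
    rw [map_sub, hC, map_mul, hX] at this
    linear_combination this - hr
  obtain ⟨s, hs⟩ : X ∣ (1 + X * c) ^ m - 1 := by
    refine Dvd.dvd.trans ⟨c, by ring⟩ (sub_one_dvd_pow_sub_one (1 + X * c) m)
  refine ⟨s * φ b + ((1 + X * c) * φ r - r), ?_⟩
  rw [shiftDiff_apply, map_mul, map_pow, hX, mul_pow]
  linear_combination X ^ m * φ b * hs + X ^ m * hb

theorem X_pow_dvd_shiftDiff_pow (hφ : X ^ 2 ∣ φ X - X) {m : ℕ} {g : PowerSeries K}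
    (hg : X ^ m ∣ g) (n : ℕ) : X ^ (m + n) ∣ (shiftDiff φ ^ n) g := by
  induction n with
  | zero => simpa using hg
  | succ n ih =>
    rw [pow_succ', Module.End.mul_apply]
    exact X_pow_dvd_shiftDiff hφ ih

theorem coeff_shiftDiff_pow_eq_zero (hφ : X ^ 2 ∣ φ X - X) {j n : ℕ} (hj : j < n)
    (g : PowerSeries K) : coeff j ((shiftDiff φ ^ n) g) = 0 := by
  have := X_pow_dvd_shiftDiff_pow hφ (m := 0) (g := g) (by simp) n
  rw [zero_add] at this
  exact X_pow_dvd_iff.1 this j hj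

theorem coeff_iterate_algHom (hφ : X ^ 2 ∣ φ X - X) (N j : ℕ) (g : PowerSeries K) :
    coeff j (φ^[N] g) =
      ∑ n ∈ Finset.range (j + 1), (N.choose n : K) * coeff j ((shiftDiff φ ^ n) g) := by
  have h1 : φ^[N] g = ((shiftDiff φ + 1) ^ N) g := by
    rw [shiftDiff, sub_add_cancel, Module.End.pow_apply]
    rfl
  rw [h1, (Commute.one_right (shiftDiff φ)).add_pow, LinearMap.sum_apply, map_sum]
  have h2 : ∀ n, coeff j ((shiftDiff φ ^ n * 1 ^ (N - n) * (N.choose n : Module.End K (PowerSeries K)) :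
      Module.End K (PowerSeries K)) g) =
      (N.choose n : K) * coeff j ((shiftDiff φ ^ n) g) := fun n => by
    rw [one_pow, mul_one, ← nsmul_eq_mul', LinearMap.smul_apply, map_nsmul, nsmul_eq_mul]
  simp_rw [h2]
  have h3 : ∀ M, N + 1 ≤ M → ∑ n ∈ Finset.range (N + 1), (N.choose n : K) *
      coeff j ((shiftDiff φ ^ n) g) =
      ∑ n ∈ Finset.range M, (N.choose n : K) * coeff j ((shiftDiff φ ^ n) g) := fun M hM => by
    refine Finset.sum_subset (Finset.range_mono hM) fun n _ hn => ?_
    rw [Nat.choose_eq_zero_of_lt (by simpa using hn), Nat.cast_zero, zero_mul]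
  rw [h3 (N + 1 + (j + 1)) (Nat.le_add_right _ _)]
  symm
  refine Finset.sum_subset (Finset.range_mono (Nat.le_add_left _ _)) fun n _ hn => ?_
  rw [coeff_shiftDiff_pow_eq_zero hφ (by simpa using hn), mul_zero]

/-- The polynomial in `N` that gives the `j`-th coefficient of the `N`-th iterate of `φ` at `g`. -/
noncomputable def flowPoly (φ : PowerSeries K →ₐ[K] PowerSeries K) (g : PowerSeries K) (j : ℕ) :
    Polynomial K :=
  ∑ n ∈ Finset.range (j + 1),
    Polynomial.C (coeff j ((shiftDiff φ ^ n) g) / n.factorial) * descPochhammer K n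

/-- The logarithm of `φ`, defined as `∑_{n ≥ 1} (-1)^(n+1) (φ - 1)^n / n`. -/
noncomputable def logOperator (φ : PowerSeries K →ₐ[K] PowerSeries K) (g : PowerSeries K) :
    PowerSeries K :=
  PowerSeries.mk fun j =>
    ∑ n ∈ Finset.Icc 1 j, (-1) ^ (n + 1) / (n : K) * coeff j ((shiftDiff φ ^ n) g)

theorem map_logOperator (hφ : X ^ 2 ∣ φ X - X) (g : PowerSeries K) :
    φ (logOperator φ g) = logOperator φ (φ g) := by
  ext m
  -- A truncation of the logarithm is a polynomial in `φ` and so commutes with it; it agrees with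
  -- the full series up to degree `m`.
  set L : Module.End K (PowerSeries K) :=
    ∑ n ∈ Finset.Icc 1 m, ((-1) ^ (n + 1) / (n : K)) • shiftDiff φ ^ n with hL
  have hLcoeff : ∀ j ≤ m, ∀ a, coeff j (L a) = coeff j (logOperator φ a) := fun j hj a => by
    rw [hL, LinearMap.sum_apply, map_sum, logOperator, coeff_mk]
    simp only [LinearMap.smul_apply, map_smul, smul_eq_mul]
    symm
    refine Finset.sum_subset (Finset.Icc_subset_Icc_right hj) fun n hn hn' => ?_
    rw [coeff_shiftDiff_pow_eq_zero hφ, mul_zero]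
    simp only [Finset.mem_Icc] at hn hn'
    omega
  have hcomm : Commute φ.toLinearMap L := by
    refine Commute.sum_right _ _ _ fun n _ => Commute.smul_right (Commute.pow_right ?_ n) _
    exact (Commute.refl _).sub_right (Commute.one_right _)
  have hφL : φ (L g) = L (φ g) := LinearMap.congr_fun hcomm.eq g
  obtain ⟨r, hr⟩ : X ^ (m + 1) ∣ logOperator φ g - L g :=
    X_pow_dvd_iff.2 fun j hj => by rw [map_sub, hLcoeff j (Nat.lt_succ_iff.1 hj), sub_self]
  have hφr : X ^ (m + 1) ∣ φ (X ^ (m + 1) * r) := by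
    obtain ⟨c, hc⟩ := hφ
    rw [map_mul, map_pow, show φ X = X * (1 + X * c) by linear_combination hc, mul_pow, mul_assoc]
    exact dvd_mul_right _ _
  rw [← hLcoeff m le_rfl, ← hφL, ← sub_eq_zero, ← map_sub, ← map_sub, hr]
  exact X_pow_dvd_iff.1 hφr m m.lt_succ_self

theorem X_pow_dvd_logOperator (hφ : X ^ 2 ∣ φ X - X) {m : ℕ} {g : PowerSeries K}
    (hg : X ^ m ∣ g) : X ^ (m + 1) ∣ logOperator φ g := by
  refine X_pow_dvd_iff.2 fun j hj => ?_
  rw [logOperator, coeff_mk]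
  refine Finset.sum_eq_zero fun n hn => ?_
  have := X_pow_dvd_iff.1 (X_pow_dvd_shiftDiff_pow hφ hg n) j (by
    have := (Finset.mem_Icc.1 hn).1
    omega)
  rw [this, mul_zero]

theorem coeff_shiftDiff (hφ : X ^ 2 ∣ φ X - X) (g : PowerSeries K) (j : ℕ) :
    coeff j (shiftDiff φ g) =
      ∑ k ∈ Finset.range (j + 1), coeff k g * coeff j (shiftDiff φ (X ^ k)) := by
  obtain ⟨r, hr⟩ : X ^ (j + 1) ∣ g - ∑ k ∈ Finset.range (j + 1), coeff k g • X ^ k := by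
    refine X_pow_dvd_iff.2 fun i hi => ?_
    rw [map_sub, map_sum]
    simp [coeff_X_pow, hi]
  have h := X_pow_dvd_iff.1 (X_pow_dvd_shiftDiff hφ ⟨r, hr⟩) j (by omega)
  rw [map_sub, map_sub, sub_eq_zero, map_sum, map_sum] at h
  simpa using h

variable [CharZero K]

theorem eval_flowPoly (hφ : X ^ 2 ∣ φ X - X) (g : PowerSeries K) (j N : ℕ) :
    (flowPoly φ g j).eval (N : K) = coeff j (φ^[N] g) := by
  rw [coeff_iterate_algHom hφ, flowPoly, Polynomial.eval_finsetSum]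
  refine Finset.sum_congr rfl fun n _ => ?_
  have : (n.factorial : K) ≠ 0 := Nat.cast_ne_zero.2 n.factorial_ne_zero
  rw [Polynomial.eval_mul, Polynomial.eval_C, descPochhammer_eval_eq_descFactorial,
    Nat.descFactorial_eq_factorial_mul_choose]
  push_cast
  field_simp

theorem eval_derivative_flowPoly (g : PowerSeries K) (j : ℕ) :
    (Polynomial.derivative (flowPoly φ g j)).eval 0 = coeff j (logOperator φ g) := by
  rw [logOperator, coeff_mk, flowPoly, Polynomial.derivative_sum, Polynomial.eval_finsetSum,
    Finset.sum_range_succ']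
  simp only [Polynomial.derivative_C_mul, Polynomial.eval_mul, Polynomial.eval_C,
    eval_zero_derivative_descPochhammer, descPochhammer_zero, Polynomial.derivative_one,
    Polynomial.eval_zero, mul_zero, add_zero]
  rw [← Finset.Ico_add_one_right_eq_Icc, Finset.sum_Ico_eq_sum_range, Nat.add_sub_cancel]
  refine Finset.sum_congr rfl fun n _ => ?_
  have h1 : (n.factorial : K) ≠ 0 := Nat.cast_ne_zero.2 n.factorial_ne_zero
  have h2 : (n : K) + 1 ≠ 0 := Nat.cast_add_one_ne_zero n
  rw [add_comm 1 n, Nat.factorial_succ]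
  push_cast
  field_simp
  ring

/-- Multiplicativity of `φ^N` for all natural `N` is an identity of polynomials in `N`; its
derivative at `N = 0` is the Leibniz rule. -/
theorem logOperator_mul (hφ : X ^ 2 ∣ φ X - X) (a b : PowerSeries K) :
    logOperator φ (a * b) = a * logOperator φ b + b * logOperator φ a := by
  have hflow : ∀ j, flowPoly φ (a * b) j =
      ∑ p ∈ Finset.HasAntidiagonal.antidiagonal j, flowPoly φ a p.1 * flowPoly φ b p.2 := fun j => by
    refine Polynomial.eq_of_infinite_eval_eq _ _
      ((Set.infinite_range_of_injective (Nat.cast_injective (R := K))).mono ?_)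
    rintro _ ⟨N, rfl⟩
    rw [Set.mem_ofPred_eq, eval_flowPoly hφ, iterate_map_mul, coeff_mul, Polynomial.eval_finsetSum]
    refine Finset.sum_congr rfl fun p _ => ?_
    rw [Polynomial.eval_mul, eval_flowPoly hφ, eval_flowPoly hφ]
  have hzero : ∀ g j, (flowPoly φ g j).eval 0 = coeff j g := fun g j => by
    simpa using eval_flowPoly hφ g j 0
  ext j
  rw [← eval_derivative_flowPoly, hflow, Polynomial.derivative_sum, Polynomial.eval_finsetSum,
    map_add, mul_comm b, coeff_mul, coeff_mul, ← Finset.sum_add_distrib]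
  refine Finset.sum_congr rfl fun p _ => ?_
  rw [Polynomial.derivative_mul, Polynomial.eval_add, Polynomial.eval_mul, Polynomial.eval_mul,
    eval_derivative_flowPoly, eval_derivative_flowPoly, hzero, hzero, add_comm]

/-- The logarithm of a substitution is a derivation. -/
noncomputable def logDerivation (φ : PowerSeries K →ₐ[K] PowerSeries K) (hφ : X ^ 2 ∣ φ X - X) :
    Derivation K (PowerSeries K) (PowerSeries K) :=
  Derivation.mk'
    { toFun := logOperator φ
      map_add' := fun a b => by
        ext j
        simp only [logOperator, coeff_mk, map_add, mul_add, Finset.sum_add_distrib]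
      map_smul' := fun c a => by
        ext j
        simp only [logOperator, coeff_mk, map_smul, smul_eq_mul, RingHom.id_apply, Finset.mul_sum]
        exact Finset.sum_congr rfl fun n _ => by ring }
    fun a b => logOperator_mul hφ a b

theorem logDerivation_apply (hφ : X ^ 2 ∣ φ X - X) (g : PowerSeries K) :
    logDerivation φ hφ g = logOperator φ g := rfl

theorem logOperator_eq (hφ : X ^ 2 ∣ φ X - X) (g : PowerSeries K) :
    logOperator φ g = logOperator φ X * derivative K g := by
  have h := derivation_eq_zero_of_X (logDerivation φ hφ - logOperator φ X • derivative K) (by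
    rw [Derivation.sub_apply, Derivation.smul_apply, derivative_X, logDerivation_apply,
      smul_eq_mul, mul_one, sub_self])
  have := DFunLike.congr_fun h g
  rwa [Derivation.sub_apply, Derivation.smul_apply, logDerivation_apply, smul_eq_mul,
    Derivation.zero_apply, sub_eq_zero] at this

/-- Julia's equation for the iterative logarithm. -/
theorem julia_logOperator (hφ : X ^ 2 ∣ φ X - X) :
    φ (logOperator φ X) = derivative K (φ X) * logOperator φ X := by
  rw [map_logOperator hφ, logOperator_eq hφ (φ X), mul_comm]

end Logarithm

/-! ### Iteration matrices and the iterative logarithm -/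

section IterativeLogarithm

open PowerSeries

variable {K : Type*} [Field K] [CharZero K] {φ : PowerSeries K →ₐ[K] PowerSeries K}

theorem triPow_iterationMatrix (hφ : X ^ 2 ∣ φ X - X) {Ω : ℕ → ℚ} (hΩ : ∀ n, Ω n ≠ 0)
    (n i j : ℕ) : triPow (iterationMatrix Ω (φ X) - triOne K) n i j =
      ((Ω i / Ω j : ℚ) : K) * coeff j ((shiftDiff φ ^ n) (X ^ i)) := by
  have hΩK : ∀ n, (Ω n : K) ≠ 0 := fun n => Rat.cast_ne_zero.2 (hΩ n)
  induction n generalizing j with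
  | zero =>
    rw [triPow, triOne, pow_zero, Module.End.one_apply, coeff_X_pow]
    by_cases h : i = j
    · subst h
      simp [hΩ i]
    · rw [if_neg h, if_neg (Ne.symm h), mul_zero]
  | succ n ih =>
    rw [triPow, triMul, pow_succ', Module.End.mul_apply, coeff_shiftDiff hφ, Finset.mul_sum]
    refine Finset.sum_congr rfl fun k _ => ?_
    have hM : (iterationMatrix Ω (φ X) - triOne K) k j =
        ((Ω k / Ω j : ℚ) : K) * coeff j (shiftDiff φ (X ^ k)) := by
      rw [Pi.sub_apply, Pi.sub_apply, iterationMatrix, triOne, shiftDiff_apply, map_sub, map_pow φ,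
        coeff_X_pow, mul_sub]
      congr 1
      by_cases h : k = j
      · subst h
        simp [hΩ k]
      · rw [if_neg h, if_neg (Ne.symm h), mul_zero]
    rw [ih, hM]
    have := hΩK k
    push_cast
    field_simp

theorem triLog_iterationMatrix (hφ : X ^ 2 ∣ φ X - X) {Ω : ℕ → ℚ} (hΩ : ∀ n, Ω n ≠ 0)
    (i j : ℕ) : triLog (iterationMatrix Ω (φ X)) i j =
      ((Ω i / Ω j : ℚ) : K) * coeff j (logOperator φ (X ^ i)) := by
  rw [triLog, logOperator, coeff_mk, Finset.mul_sum]
  refine Finset.sum_congr rfl fun n _ => ?_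
  rw [triPow_iterationMatrix hφ hΩ]
  ring

theorem isIterativeLog_iff (hφ : X ^ 2 ∣ φ X - X) (h : PowerSeries K) :
    IsIterativeLog (φ X) h ↔ h = logOperator φ X := by
  have hX : X ^ 2 ∣ logOperator φ X := X_pow_dvd_logOperator hφ (m := 1) (by simp)
  constructor
  · rintro ⟨hdvd, hlog⟩
    ext j
    rcases j with _ | j
    · rw [X_pow_dvd_iff.1 hdvd 0 two_pos, X_pow_dvd_iff.1 hX 0 two_pos]
    -- Row `1` for the constant reference sequence already lists the coefficients of `h`.
    · have h1 := congrFun (congrFun (hlog (fun _ => 1) ⟨fun _ => one_ne_zero, rfl, rfl⟩) 1) (j + 1)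
      rw [triLog_iterationMatrix hφ fun _ => one_ne_zero] at h1
      simpa [infinitesimalMatrix] using h1.symm
  · rintro rfl
    refine ⟨hX, fun Ω hΩ => ?_⟩
    funext i j
    rw [triLog_iterationMatrix hφ hΩ.1, infinitesimalMatrix]
    split_ifs with hij
    · rw [mul_assoc]
      congr 1
      rw [logOperator_eq hφ, Derivation.leibniz_pow, derivative_X]
      rcases i with _ | i
      · simp
      · rw [Nat.add_sub_cancel, smul_eq_mul, mul_one, nsmul_eq_mul, mul_left_comm,
          ← nsmul_eq_mul, map_nsmul, nsmul_eq_mul, coeff_mul_X_pow', if_pos (by omega),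
          show j - (i + 1) + 1 = j - i by omega]
    · rw [X_pow_dvd_iff.1 (X_pow_dvd_logOperator hφ (dvd_refl (X ^ i))) j (by omega), mul_zero]

end IterativeLogarithm

open PowerSeries

/-! ### Stirling numbers as coefficients of powers of `e^z - 1` -/

section Stirling

theorem X_sq_dvd_exp_sub_one_sub_X : (X : PowerSeries ℚ) ^ 2 ∣ exp ℚ - 1 - X := by
  refine X_pow_dvd_iff.2 fun j hj => ?_
  interval_cases j <;> simp [coeff_exp, coeff_X, coeff_one]

theorem coeff_exp_sub_one_pow (n j : ℕ) :
    coeff n ((exp ℚ - 1 : PowerSeries ℚ) ^ j) =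
      (j.factorial : ℚ) / n.factorial * Nat.stirlingSecond n j := by
  have hrec : ∀ n j : ℕ, ((n : ℚ) + 1) * coeff (n + 1) ((exp ℚ - 1 : PowerSeries ℚ) ^ (j + 1)) =
      ((j : ℚ) + 1) * (coeff n ((exp ℚ - 1 : PowerSeries ℚ) ^ (j + 1)) +
        coeff n ((exp ℚ - 1 : PowerSeries ℚ) ^ j)) := fun n j => by
    rw [mul_comm, ← coeff_derivative, Derivation.leibniz_pow, map_sub, Derivation.map_one_eq_zero,
      sub_zero, derivative_exp ℚ, Nat.add_sub_cancel, ← map_add, map_nsmul, nsmul_eq_mul,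
      smul_eq_mul]
    push_cast
    congr 2
    ring
  induction n generalizing j with
  | zero =>
    rcases j with _ | j
    · simp
    · simp [coeff_zero_eq_constantCoeff]
  | succ n ih =>
    rcases j with _ | j
    · simp [coeff_one]
    · have h := hrec n j
      rw [ih, ih] at h
      rw [Nat.stirlingSecond_succ_succ]
      have h1 : (n.factorial : ℚ) ≠ 0 := Nat.cast_ne_zero.2 n.factorial_ne_zero
      have h2 : (n : ℚ) + 1 ≠ 0 := Nat.cast_add_one_ne_zero n
      refine mul_left_cancel₀ h2 (h.trans ?_)
      rw [Nat.factorial_succ n, Nat.factorial_succ j]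
      push_cast
      field_simp

end Stirling

/-! ### Recursion for sums over chains -/

section Chains

theorem mem_chains {n m : ℕ} {v : Fin (m + 1) → ℕ} :
    v ∈ chains n m ↔ (∀ i, 2 ≤ v i) ∧ StrictMono v ∧ v (Fin.last m) = n := by
  rw [chains, Finset.mem_filter, Fintype.mem_piFinset, Fin.strictMono_iff_lt_succ]
  constructor
  · rintro ⟨h1, h2, h3⟩
    exact ⟨fun i => (Finset.mem_Icc.1 (h1 i)).1, h2, h3⟩
  · rintro ⟨h1, h2, h3⟩
    refine ⟨fun i => Finset.mem_Icc.2 ⟨h1 i, ?_⟩, h2, h3⟩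
    rw [← h3]
    exact (Fin.strictMono_iff_lt_succ.2 h2).monotone (Fin.le_last i)

/-- The sum over the chains of length `m + 1` ending in `n` of the products of Stirling numbers. -/
def chainSum (n m : ℕ) : ℚ :=
  ∑ v ∈ chains n m, ∏ i : Fin m, (Nat.stirlingSecond (v i.succ) (v i.castSucc) : ℚ)

theorem chainSum_zero (n : ℕ) : chainSum n 0 = if 2 ≤ n then 1 else 0 := by
  rw [chainSum]
  simp only [Finset.univ_eq_empty, Finset.prod_empty, Finset.sum_const, nsmul_eq_mul, mul_one]
  have : Subsingleton (Fin (0 + 1)) := inferInstanceAs (Subsingleton (Fin 1))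
  split_ifs with h
  · have : chains n 0 = {fun _ => n} := by
      ext v
      rw [mem_chains, Finset.mem_singleton]
      constructor
      · rintro ⟨_, _, h3⟩
        funext i
        rw [← h3, Subsingleton.elim i (Fin.last 0)]
      · rintro rfl
        exact ⟨fun _ => h, Subsingleton.strictMono _, rfl⟩
    rw [this]
    simp
  · have : chains n 0 = ∅ := by
      rw [Finset.eq_empty_iff_forall_notMem]
      intro v hv
      obtain ⟨h1, _, h3⟩ := mem_chains.1 hv
      exact h (h3 ▸ h1 (Fin.last 0))
    rw [this]
    simp

/-- Sort the chains by their penultimate element `j` and delete the last one. -/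
theorem chainSum_succ (n m : ℕ) :
    chainSum n (m + 1) = ∑ j ∈ Finset.range n, chainSum j m * Nat.stirlingSecond n j := by
  rw [chainSum, ← Finset.sum_fiberwise_of_maps_to
    (g := fun v : Fin (m + 2) → ℕ => v (Fin.last m).castSucc) (t := Finset.range n)]
  · refine Finset.sum_congr rfl fun j hj => ?_
    rw [chainSum, Finset.sum_mul]
    refine Finset.sum_bij' (fun v _ => Fin.init v) (fun w _ => Fin.snoc (α := fun _ => ℕ) w n)
      ?_ ?_ ?_ ?_ ?_
    · intro v hv
      obtain ⟨hv, hvj⟩ := Finset.mem_filter.1 hv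
      obtain ⟨h1, h2, _⟩ := mem_chains.1 hv
      exact mem_chains.2 ⟨fun i => h1 _, h2.comp (Fin.strictMono_castSucc), hvj⟩
    · intro w hw
      obtain ⟨h1, h2, h3⟩ := mem_chains.1 hw
      have hjn := Finset.mem_range.1 hj
      refine Finset.mem_filter.2 ⟨mem_chains.2 ⟨fun i => ?_, ?_, ?_⟩, ?_⟩
      · refine Fin.lastCases ?_ (fun i => ?_) i
        · rw [Fin.snoc_last]
          exact ((h1 (Fin.last m)).trans_eq h3).trans hjn.le
        · rw [Fin.snoc_castSucc]
          exact h1 i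
      · rw [Fin.strictMono_iff_lt_succ]
        intro i
        refine Fin.lastCases ?_ (fun i => ?_) i
        · rw [Fin.snoc_castSucc, Fin.succ_last, Fin.snoc_last, h3]
          exact hjn
        · rw [Fin.snoc_castSucc, Fin.succ_castSucc, Fin.snoc_castSucc]
          exact h2 i.castSucc_lt_succ
      · rw [Fin.snoc_last]
      · rw [Fin.snoc_castSucc, h3]
    · intro v hv
      have h3 := (mem_chains.1 (Finset.mem_filter.1 hv).1).2.2
      change Fin.snoc (α := fun _ => ℕ) (Fin.init v) n = v
      rw [← h3]
      exact Fin.snoc_init_self v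
    · intro w _
      exact Fin.init_snoc (α := fun _ => ℕ) n w
    · intro v hv
      obtain ⟨hv, hvj⟩ := Finset.mem_filter.1 hv
      rw [Fin.prod_univ_castSucc, Fin.succ_last, (mem_chains.1 hv).2.2, hvj]
      rfl
  · intro v hv
    obtain ⟨_, h2, h3⟩ := mem_chains.1 hv
    rw [Finset.mem_range, ← h3]
    exact h2 (Fin.castSucc_lt_last _)

end Chains

/-! ### The case of `e^z - 1` -/

section MainTheorem

/-- Substitution of `e^z - 1`. -/
noncomputable def expSubst : PowerSeries ℚ →ₐ[ℚ] PowerSeries ℚ :=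
  substAlgHom (HasSubst.of_constantCoeff_zero' (by simp) : HasSubst (exp ℚ - 1 : PowerSeries ℚ))

theorem expSubst_X : expSubst X = exp ℚ - 1 := substAlgHom_X _

theorem X_sq_dvd_expSubst : X ^ 2 ∣ expSubst X - X := by
  rw [expSubst_X]
  exact X_sq_dvd_exp_sub_one_sub_X

theorem coeff_shiftDiff_expSubst_pow (m n : ℕ) :
    coeff n ((shiftDiff expSubst ^ (m + 1)) X) = chainSum n m / n.factorial := by
  induction m generalizing n with
  | zero =>
    rw [chainSum_zero, zero_add, pow_one, shiftDiff_apply, expSubst_X]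
    split_ifs with h
    · obtain ⟨k, rfl⟩ := Nat.exists_eq_add_of_le' h
      simp [coeff_exp, coeff_one, coeff_X]
    · rw [zero_div]
      exact X_pow_dvd_iff.1 X_sq_dvd_exp_sub_one_sub_X n (not_le.1 h)
  | succ m ih =>
    rw [pow_succ', Module.End.mul_apply, coeff_shiftDiff X_sq_dvd_expSubst, Finset.sum_range_succ,
      chainSum_succ, Finset.sum_div]
    have hlast : coeff n (shiftDiff expSubst (X ^ n)) = 0 :=
      X_pow_dvd_iff.1 (X_pow_dvd_shiftDiff X_sq_dvd_expSubst (dvd_refl (X ^ n))) n n.lt_succ_self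
    rw [hlast, mul_zero, add_zero]
    refine Finset.sum_congr rfl fun j hj => ?_
    rw [ih, shiftDiff_apply, map_sub, map_pow expSubst, expSubst_X, coeff_exp_sub_one_pow,
      coeff_X_pow, if_neg (Finset.mem_range.1 hj).ne', sub_zero]
    have h1 : (j.factorial : ℚ) ≠ 0 := Nat.cast_ne_zero.2 j.factorial_ne_zero
    field_simp

theorem cSeq_eq (n : ℕ) :
    cSeq n = ∑ m ∈ Finset.range (n - 1), (-1) ^ (m + 2) / ((m : ℚ) + 1) * chainSum n m := by
  simp only [cSeq, chainSum, Finset.mul_sum]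

theorem logOperator_expSubst : logOperator expSubst X = cEgf := by
  ext n
  have hX := X_pow_dvd_logOperator X_sq_dvd_expSubst (m := 1) (g := X) (by simp)
  rw [cEgf, coeff_mk, cSeq_eq]
  rcases n with _ | n
  · rw [X_pow_dvd_iff.1 hX 0 two_pos]
    simp
  -- The logarithm sums one power more than `cSeq`; that term vanishes because its order is at least
  -- `n + 2`.
  · have htop : coeff (n + 1) ((shiftDiff expSubst ^ (n + 1)) X) = 0 :=
      X_pow_dvd_iff.1 (X_pow_dvd_shiftDiff_pow X_sq_dvd_expSubst (m := 1) (g := X) (by simp)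
        (n + 1)) (n + 1) (by omega)
    rw [logOperator, coeff_mk, ← Finset.Ico_add_one_right_eq_Icc, Finset.sum_Ico_eq_sum_range,
      Nat.add_sub_cancel, Nat.add_sub_cancel, Finset.sum_range_succ, add_comm 1 n, htop, mul_zero,
      add_zero, Finset.sum_div]
    refine Finset.sum_congr rfl fun m _ => ?_
    rw [add_comm 1 m, coeff_shiftDiff_expSubst_pow]
    push_cast
    ring

theorem cEgf_ne_zero : cEgf ≠ 0 := by
  intro h
  have h2 := congrArg (coeff 2) h
  rw [cEgf, coeff_mk, cSeq_eq] at h2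
  simp [chainSum_zero] at h2

theorem julia_cEgf : cEgf.subst (exp ℚ - 1 : PowerSeries ℚ) = exp ℚ * cEgf := by
  have h := julia_logOperator X_sq_dvd_expSubst
  rw [logOperator_expSubst, expSubst_X, map_sub, Derivation.map_one_eq_zero, sub_zero,
    derivative_exp ℚ, expSubst, coe_substAlgHom] at h
  exact h

theorem differentiallyTranscendental_map_cEgf :
    DifferentiallyTranscendental (PowerSeries.map (algebraMap ℚ ℂ) cEgf) := by
  refine differentiallyTranscendental_of_julia (fun h => cEgf_ne_zero ?_) ?_
  · exact PowerSeries.map_injective _ (algebraMap ℚ ℂ).injective (h.trans (map_zero _).symm)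
  · have hsub : HasSubst (exp ℚ - 1 : PowerSeries ℚ) :=
      HasSubst.of_constantCoeff_zero' (by simp)
    have h := congrArg (PowerSeries.map (algebraMap ℚ ℂ)) julia_cEgf
    rw [map_mul, map_exp] at h
    rw [← h]
    have hmap : PowerSeries.map (algebraMap ℚ ℂ) (cEgf.subst (exp ℚ - 1 : PowerSeries ℚ)) =
        (PowerSeries.map (algebraMap ℚ ℂ) cEgf).subst
          (PowerSeries.map (algebraMap ℚ ℂ) (exp ℚ - 1)) := map_subst hsub cEgf
    rw [hmap, map_sub, map_exp, map_one]

/-- Lets transcendence over `ℚ[z]` follow from transcendence over `ℂ[z]`. -/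
theorem DifferentiallyAlgebraic.map {K L : Type*} [Field K] [Field L] (i : K →+* L)
    {f : PowerSeries K} (hf : DifferentiallyAlgebraic f) :
    DifferentiallyAlgebraic (PowerSeries.map i f) := by
  obtain ⟨P, hP0, hP⟩ := hf
  have hder : ∀ n, (derivative L)^[n] (PowerSeries.map i f) =
      PowerSeries.map i ((derivative K)^[n] f) := fun n => by
    induction n with
    | zero => rfl
    | succ n ih =>
      rw [Function.iterate_succ_apply', Function.iterate_succ_apply', ih]
      ext k
      simp [coeff_derivative]
  have heval : ∀ Q : MvPolynomial ℕ (Polynomial K),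
      MvPolynomial.aeval (fun n => (derivative L)^[n] (PowerSeries.map i f))
        (MvPolynomial.map (Polynomial.mapRingHom i) Q) =
      PowerSeries.map i (MvPolynomial.aeval (fun n => (derivative K)^[n] f) Q) := fun Q => by
    induction Q using MvPolynomial.induction_on with
    | C p =>
      rw [MvPolynomial.map_C, MvPolynomial.aeval_C, MvPolynomial.aeval_C,
        PowerSeries.algebraMap_apply', PowerSeries.algebraMap_apply']
      ext k
      simp
    | add p q hp hq => simp only [map_add, hp, hq]
    | mul_X p n hp => rw [map_mul, map_mul, map_mul, map_mul, hp, MvPolynomial.map_X,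
        MvPolynomial.aeval_X, MvPolynomial.aeval_X, hder]
  refine ⟨MvPolynomial.map (Polynomial.mapRingHom i) P, fun h => hP0 ?_, ?_⟩
  · exact MvPolynomial.map_injective _ (Polynomial.map_injective i i.injective)
      (h.trans (map_zero _).symm)
  · rw [heval, hP, map_zero]

end MainTheorem

end IterLog

theorem mainTheorem6 :
    (∀ h : PowerSeries ℚ, IterLog.IsIterativeLog (PowerSeries.exp ℚ - 1) h ↔ h = IterLog.cEgf) ∧
      IterLog.DifferentiallyTranscendental IterLog.cEgf ∧
      IterLog.DifferentiallyTranscendental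
        (PowerSeries.map (algebraMap ℚ ℂ) IterLog.cEgf) := by
  refine ⟨fun h => ?_, fun hda => ?_, IterLog.differentiallyTranscendental_map_cEgf⟩
  · rw [← IterLog.expSubst_X, IterLog.isIterativeLog_iff IterLog.X_sq_dvd_expSubst,
      IterLog.logOperator_expSubst]
  · exact IterLog.differentiallyTranscendental_map_cEgf (hda.map (algebraMap ℚ ℂ))
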